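/- Let $k>0$, $\alpha,\mu\in\{-1,1\}$. For $c\in(-k,0)$ let $\vartheta_\pm(c)=\arctan\frac{k\pm\sqrt{k^2-c^2}}{-c}$, so that $0<\vartheta_-(c)<\pi/4<\vartheta_+(c)<\pi/2$. All differential equations below are considered on $(0,\infty)$. *The sets $\mathcal C_m$ ($m\in\mathbb N_0$).* If $\alpha=1$, only $m=0$ is admissible, and $\mathcal C_0=(-k,0)$. If $\alpha=-1$, let $\vartheta_0(\cdot,c)$ be the solution of $$\varrho\,\vartheta'=c+\Bigl(k-\frac1\varrho\Bigr)\sin 2\vartheta ,\qquad \lim_{\varrho\to0}\vartheta_0(\varrho,c)=\pi ,$$ and let the exceptional value $c_m$ be the point $c\in(-k,0)$, if it exists, with $\lim_{\varrho\to\infty}\vartheta_0(\varrho,c)=\vartheta_-(c)-m\pi$; these values satisfy $0>c_0>c_1>\dots>-k$. Set $c_{-1}=0$. Then $\mathcal C_m=(c_m,c_{m-1})$ if $c_m$ exists, and $\mathcal C_m=(-k,c_{m-1})$ if $c_{m-1}$ exists but $c_m$ does not. **Proposition 3.3.** Let $c\in\mathcal C_m$. For $a<0$ and $\lambda\in[-1,1]$,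 the equation $$\Theta'=\frac cr+\Bigl(\frac kr+\frac{\alpha|a|}{r^2}\Bigr)\sin2\Theta+\mu\cos2\Theta-\lambda$$ has exactly one solution $\Theta_0(\cdot,c,a,\lambda)$ with $\lim_{r\to0}\Theta_0=\pi/2$ if $\alpha=1$, and $\lim_{r\to0}\Theta_0=\pi$ if $\alpha=-1$; and the equation $$X'=\frac cr+\frac kr\sin2X+\mu\cos2X-\lambda$$ has exactly one solution $X_0(\cdot,c,\lambda)$ with $\lim_{r\to0}X_0=\vartheta_+(c)$. There is $R>0$ (independent of $a$ and $\lambda$) such that $$\lim_{a\to0,\ a<0}\bigl(\Theta_0(R,c,a,\lambda)+m\pi\bigr)=X_0(R,c,\lambda)\qquad\text{uniformly with respect to }\lambda\in[-1,1].$$ -/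

import Mathlib

open Real Set Filter Topology

/-- `u` is a solution on `(0, ∞)` of the first-order equation `u' = F r u` with limit `l` at the
singular end-point `0`. -/
def IsSolutionFromZero (F : ℝ → ℝ → ℝ) (l : ℝ) (u : ℝ → ℝ) : Prop :=
  (∀ r : ℝ, 0 < r → HasDerivAt u (F r (u r)) r) ∧ Tendsto u (𝓝[>] 0) (𝓝 l)

/-- There is exactly one function on `(0, ∞)` which solves `u' = F r u` and has limit `l` at `0`
(values at non-positive arguments are irrelevant). -/
def HasUniqueSolutionFromZero (F : ℝ → ℝ → ℝ) (l : ℝ) : Prop :=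
  ∃ u : ℝ → ℝ, IsSolutionFromZero F l u ∧
    ∀ v : ℝ → ℝ, IsSolutionFromZero F l v → EqOn v u (Ioi 0)

/-- The solution of `u' = F r u` on `(0, ∞)` with limit `l` at `0`. -/
noncomputable def solutionFromZero (F : ℝ → ℝ → ℝ) (l : ℝ) : ℝ → ℝ :=
  Classical.epsilon (IsSolutionFromZero F l)

/-- The asymptotic zero `ϑ₊(c) ∈ (π/4, π/2)`, for `-k < c < 0`. -/
noncomputable def thetaPlus (k c : ℝ) : ℝ := arctan ((k + √(k ^ 2 - c ^ 2)) / (-c))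

/-- The asymptotic zero `ϑ₋(c) ∈ (0, π/4)`, for `-k < c < 0`. -/
noncomputable def thetaMinus (k c : ℝ) : ℝ := arctan ((k - √(k ^ 2 - c ^ 2)) / (-c))

/-- Right-hand side of the simplified equation `ϱ ϑ' = c + (k + α / ϱ) sin 2ϑ`, solved for `ϑ'`. -/
noncomputable def simplifiedField (k α c : ℝ) (ρ θ : ℝ) : ℝ :=
  (c + (k + α / ρ) * sin (2 * θ)) / ρ

/-- Right-hand side of the Prüfer equation with anomaly,
`Θ' = c / r + (k / r + α |a| / r²) sin 2Θ + μ cos 2Θ - λ`. -/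
noncomputable def prueferField (k α μ c a lam : ℝ) (r θ : ℝ) : ℝ :=
  c / r + (k / r + α * |a| / r ^ 2) * sin (2 * θ) + μ * cos (2 * θ) - lam

/-- Right-hand side of the Prüfer equation without anomaly,
`X' = c / r + (k / r) sin 2X + μ cos 2X - λ`. -/
noncomputable def coulombField (k μ c lam : ℝ) (r θ : ℝ) : ℝ :=
  c / r + k / r * sin (2 * θ) + μ * cos (2 * θ) - lam

/-- The limit at `0` of the distinguished angles in the presence of the anomaly:
`π/2` if `α = 1`, and `π` if `α = -1`. -/
noncomputable def angleAtZero (α : ℝ) : ℝ := if α = 1 then π / 2 else π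

/-- `Θ₀(·, c, a, λ)`, the distinguished solution of the Prüfer equation with anomaly. -/
noncomputable def Theta0 (k α μ c a lam : ℝ) : ℝ → ℝ :=
  solutionFromZero (prueferField k α μ c a lam) (angleAtZero α)

/-- `X₀(·, c, λ)`, the distinguished solution of the Prüfer equation without anomaly. -/
noncomputable def X0 (k μ c lam : ℝ) : ℝ → ℝ :=
  solutionFromZero (coulombField k μ c lam) (thetaPlus k c)

/-- `IsExceptionalValue k m c` says that `c` is the `m`-th exceptional value `c_m` for `α = -1`: the
distinguished solution `ϑ₀(·, c)` of the simplified equation (the one with limit `π` at `0`) tends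
to the unstable limit `ϑ₋(c) - m π` at `∞`. -/
def IsExceptionalValue (k : ℝ) (m : ℕ) (c : ℝ) : Prop :=
  c ∈ Ioo (-k) 0 ∧
    ∃ θ : ℝ → ℝ, IsSolutionFromZero (simplifiedField k (-1) c) (angleAtZero (-1)) θ ∧
      Tendsto θ atTop (𝓝 (thetaMinus k c - m * π))

/-- `IsBelowPrevious k m c` says `c < c_{m-1}`, where `c_{-1} = 0`; it includes the requirement that
`c_{m-1}` exists. -/
def IsBelowPrevious (k : ℝ) : ℕ → ℝ → Prop
  | 0, c => c < 0
  | j + 1, c => ∃ y : ℝ, IsExceptionalValue k j y ∧ c < y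

/-- The set `𝒞_m`. For `α = 1`, `𝒞_0 = (-k, 0)`, and there are no other admissible `m`.
For `α = -1`, `𝒞_m = (c_m, c_{m-1})` if `c_m` exists (with `c_{-1} = 0`),
`𝒞_m = (-k, c_{m-1})` if `c_{m-1}` exists, but `c_m` does not, and `𝒞_m` is empty otherwise. -/
def admissibleSet (k α : ℝ) (m : ℕ) : Set ℝ :=
  {c | c ∈ Ioo (-k) 0 ∧
    ((α = 1 ∧ m = 0) ∨
      (α = -1 ∧ (∀ x : ℝ, IsExceptionalValue k m x → x < c) ∧ IsBelowPrevious k m c))}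

/-!
# Convergence of the distinguished Prüfer angles as the anomaly is removed

The argument compares two scales. In the variable `ϱ = r / |a|` the equation for `Θ₀` is the
simplified equation up to an error `O(|a| ϱ)`, uniformly in `λ ∈ [-1, 1]`
(`hasDerivAt_comp_abs_mul`). Near `ϱ = 0` the term `α sin 2ϑ / ϱ²` contracts towards the
distinguished solution, so that on every bounded interval `(0, T]` the scaled angle is uniformly
close to the distinguished solution `ϑ₀` of the simplified equation
(`exists_forall_abs_sub_le_of_perturbation`). For `c ∈ 𝒞_m` the latter tends to `ϑ₊(c) - m π`
(`tendsto_of_mem_admissibleSet`). Hence, for `T` large and `|a|` small, `Θ₀ + m π` is close to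
`ϑ₊(c)` at `r = |a| T`, and so is `X₀`, whose equation is contracting near `ϑ₊(c)`. For
`r ≥ |a| T` the anomalous term is at most `1 / (T r)`, too small to overcome this contraction, so the
two angles stay close up to a fixed `R` (`abs_sub_le_of_pruefer_of_coulomb`). All these estimates
are fence arguments: `|w|` cannot cross a barrier `B` if `w w' < B B'` whenever `|w| = B`.

For `α = -1` the limit of `ϑ₀` is found by connectedness. The solution is nondecreasing and
continuous in `c`, and both "`ϑ₀` falls below `-m π`" and "`ϑ₀` stays above `π / 4 - m π`" are open
conditions on `c`; a parameter satisfying neither is an exceptional value `c_m`. Since there is none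
in `[c, c_{m-1})`, and the second condition holds at `c_{m-1}` (for `m = 0`: near `c = 0`, where `ϑ₀`
is almost constant `π`), it holds at `c` (`mem_staysAbove_of_lt`). Comparison with the solution for
`c_{m-1}` gives the upper bound that singles out `ϑ₊(c) - m π` among the stable limits.

Existence of a solution with prescribed limit at `0` follows by compactness from the solutions with
that value at `1 / (n + 1)`, which are trapped near it; uniqueness follows because the equation is
contracting there.
-/

/-! ### Global solutions of scalar equations on the half-line -/

/-- A right-hand side `F r x` on `(0, ∞) × ℝ` to which the Cauchy–Lipschitz theory applies globally:
continuous in `r`, and bounded and Lipschitz in `x` with constants that are uniform for `r` in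
compact subintervals of `(0, ∞)`. -/
structure RegularField (F : ℝ → ℝ → ℝ) : Prop where
  continuousOn : ∀ x, ContinuousOn (fun r => F r x) (Ioi 0)
  lipschitz : ∀ a b, 0 < a → ∃ K : NNReal, ∀ r ∈ Icc a b, LipschitzWith K (F r)
  bounded : ∀ a b, 0 < a → ∃ M : NNReal, ∀ r ∈ Icc a b, ∀ x, |F r x| ≤ M

namespace RegularField

variable {F : ℝ → ℝ → ℝ}

theorem exists_solution_Icc (hF : RegularField F) {a b t₀ : ℝ} (ha : 0 < a) (h₀ : t₀ ∈ Icc a b)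
    (x₀ : ℝ) :
    ∃ u : ℝ → ℝ, u t₀ = x₀ ∧ ∀ t ∈ Icc a b, HasDerivWithinAt u (F t (u t)) (Icc a b) t := by
  obtain ⟨K, hK⟩ := hF.lipschitz a b ha
  obtain ⟨M, hM⟩ := hF.bounded a b ha
  have h : IsPicardLindelof F (⟨t₀, h₀⟩ : Icc a b) x₀ (M * (b - a).toNNReal) 0 M K := by
    refine ⟨fun t ht => (hK t ht).lipschitzOnWith, fun x _ => (hF.continuousOn x).mono ?_,
      fun t ht x _ => hM t ht x, ?_⟩
    · exact fun t ht => lt_of_lt_of_le ha ht.1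
    · have : (0 : ℝ) ≤ b - a := sub_nonneg.2 (h₀.1.trans h₀.2)
      simp only [NNReal.coe_mul, Real.coe_toNNReal _ this, NNReal.coe_zero, sub_zero]
      refine mul_le_mul_of_nonneg_left (max_le ?_ ?_) M.2
      · linarith [h₀.1]
      · linarith [h₀.2]
  exact h.exists_eq_forall_mem_Icc_hasDerivWithinAt₀

theorem eqOn_Icc (hF : RegularField F) {a b t₀ : ℝ} {u v : ℝ → ℝ} (ha : 0 < a)
    (h₀ : t₀ ∈ Ioo a b)
    (hu : ∀ t ∈ Icc a b, HasDerivWithinAt u (F t (u t)) (Icc a b) t)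
    (hv : ∀ t ∈ Icc a b, HasDerivWithinAt v (F t (v t)) (Icc a b) t) (h : u t₀ = v t₀) :
    EqOn u v (Icc a b) := by
  obtain ⟨K, hK⟩ := hF.lipschitz a b ha
  exact ODE_solution_unique_of_mem_Icc (v := F) (s := fun _ => univ) (K := K)
    (fun t ht => (hK t (Ioo_subset_Icc_self ht)).lipschitzOnWith) h₀
    (fun t ht => (hu t ht).continuousWithinAt)
    (fun t ht => (hu t (Ioo_subset_Icc_self ht)).hasDerivAt (Icc_mem_nhds ht.1 ht.2))
    (fun _ _ => trivial) (fun t ht => (hv t ht).continuousWithinAt)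
    (fun t ht => (hv t (Ioo_subset_Icc_self ht)).hasDerivAt (Icc_mem_nhds ht.1 ht.2))
    (fun _ _ => trivial) h

theorem eqOn_Ioi (hF : RegularField F) {t₀ : ℝ} {u v : ℝ → ℝ} (h₀ : 0 < t₀)
    (hu : ∀ t, 0 < t → HasDerivAt u (F t (u t)) t)
    (hv : ∀ t, 0 < t → HasDerivAt v (F t (v t)) t) (h : u t₀ = v t₀) : EqOn u v (Ioi 0) := by
  intro r hr
  have hr : 0 < r := hr
  have hm : 0 < min t₀ r := lt_min h₀ hr
  have hM := le_max_left t₀ r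
  have hm' := min_le_left t₀ r
  refine hF.eqOn_Icc (a := min t₀ r / 2) (b := max t₀ r + 1) (by positivity)
    ⟨by linarith, by linarith⟩ (fun t ht => (hu t ?_).hasDerivWithinAt)
    (fun t ht => (hv t ?_).hasDerivWithinAt) h ⟨?_, ?_⟩
  · linarith [ht.1]
  · linarith [ht.1]
  · linarith [min_le_right t₀ r]
  · linarith [le_max_right t₀ r]

/-- Every initial value problem has a solution on all of `(0, ∞)`. -/
theorem exists_solution (hF : RegularField F) {t₀ : ℝ} (h₀ : 0 < t₀) (x₀ : ℝ) :
    ∃ u : ℝ → ℝ, u t₀ = x₀ ∧ ∀ t, 0 < t → HasDerivAt u (F t (u t)) t := by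
  have hn : ∀ n : ℕ, (0 : ℝ) < n + 2 := fun n => by positivity
  have hmem : ∀ n : ℕ, t₀ ∈ Ioo (t₀ / (n + 2)) (t₀ * (n + 2)) := fun n => by
    have : (0 : ℝ) ≤ n := n.cast_nonneg
    exact ⟨div_lt_self h₀ (by linarith), by nlinarith⟩
  choose w hw₀ hw using fun n : ℕ => hF.exists_solution_Icc (a := t₀ / (n + 2))
    (b := t₀ * (n + 2)) (div_pos h₀ (hn n)) (Ioo_subset_Icc_self (hmem n)) x₀
  have hsub : ∀ {m n : ℕ}, m ≤ n →
      Icc (t₀ / (m + 2)) (t₀ * (m + 2)) ⊆ Icc (t₀ / (n + 2)) (t₀ * (n + 2)) := fun {m n} hmn => by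
    have : (m : ℝ) ≤ n := by exact_mod_cast hmn
    exact Icc_subset_Icc (div_le_div_of_nonneg_left h₀.le (hn m) (by linarith)) (by nlinarith)
  have hle : ∀ {m n : ℕ}, m ≤ n → EqOn (w m) (w n) (Icc (t₀ / (m + 2)) (t₀ * (m + 2))) :=
    fun {m n} hmn => hF.eqOn_Icc (div_pos h₀ (hn m)) (hmem m) (hw m)
      (fun t ht => (hw n t (hsub hmn ht)).mono (hsub hmn)) ((hw₀ m).trans (hw₀ n).symm)
  -- the pieces are glued along an exhaustion of `(0, ∞)`; `N r` is a piece whose domain contains `r`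
  let N : ℝ → ℕ := fun r => ⌈r / t₀⌉₊ + ⌈t₀ / r⌉₊
  have hN : ∀ r, 0 < r → r ∈ Ioo (t₀ / (N r + 2)) (t₀ * (N r + 2)) := fun r hr => by
    have h1 := Nat.le_ceil (r / t₀)
    have h2 := Nat.le_ceil (t₀ / r)
    have h3 : (0 : ℝ) ≤ (⌈r / t₀⌉₊ : ℝ) := Nat.cast_nonneg _
    have h4 : (0 : ℝ) ≤ (⌈t₀ / r⌉₊ : ℝ) := Nat.cast_nonneg _
    have h5 : ((N r : ℕ) : ℝ) = (⌈r / t₀⌉₊ : ℝ) + (⌈t₀ / r⌉₊ : ℝ) := by simp [N]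
    rw [div_le_iff₀ h₀] at h1
    rw [div_le_iff₀ hr] at h2
    refine ⟨?_, ?_⟩
    · rw [div_lt_iff₀ (hn _), h5]; nlinarith
    · rw [h5]; nlinarith
  have heq : ∀ n : ℕ, ∀ r ∈ Ioo (t₀ / (n + 2)) (t₀ * (n + 2)), w (N r) r = w n r := fun n r hr => by
    have hr0 : 0 < r := (div_pos h₀ (hn n)).trans hr.1
    rw [hle (le_max_left (N r) n) (Ioo_subset_Icc_self (hN r hr0)),
      hle (le_max_right (N r) n) (Ioo_subset_Icc_self hr)]
  refine ⟨fun r => w (N r) r, hw₀ _, fun r hr => ?_⟩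
  have h1 := (hw (N r) r (Ioo_subset_Icc_self (hN r hr))).hasDerivAt
    (Icc_mem_nhds (hN r hr).1 (hN r hr).2)
  refine h1.congr_of_eventuallyEq ?_
  filter_upwards [Ioo_mem_nhds (hN r hr).1 (hN r hr).2] with s hs using heq _ s hs

/-- Two solutions which are close at `b` are close at every earlier point. -/
theorem abs_sub_le_of_le (hF : RegularField F) {a b : ℝ} (ha : 0 < a) :
    ∃ C : ℝ, ∀ u v : ℝ → ℝ, (∀ t, 0 < t → HasDerivAt u (F t (u t)) t) →
      (∀ t, 0 < t → HasDerivAt v (F t (v t)) t) → a ≤ b → |u a - v a| ≤ C * |u b - v b| := by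
  obtain ⟨K, hK⟩ := hF.lipschitz a b ha
  refine ⟨exp (K * (b - a)), fun u v hu hv hab => ?_⟩
  -- Grönwall's inequality, applied to the time-reversed solutions on `[-b, -a]`
  have hrev : ∀ {w : ℝ → ℝ}, (∀ t, 0 < t → HasDerivAt w (F t (w t)) t) →
      ∀ t ∈ Icc (-b) (-a), HasDerivAt (fun s => w (-s)) (-F (-t) (w (-t))) t := fun {w} hw t ht => by
    have := (hw (-t) (by linarith [ht.2])).comp t (hasDerivAt_neg t)
    simpa [Function.comp_def] using this
  have := dist_le_of_trajectories_ODE_of_mem (v := fun t x => -F (-t) x) (s := fun _ => univ)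
    (K := K) (a := -b) (b := -a) (f := fun s => u (-s)) (g := fun s => v (-s))
    (δ := dist (u b) (v b))
    (fun t ht => (LipschitzWith.of_dist_le_mul fun x y => by
      simpa [dist_neg_neg] using
        (hK (-t) ⟨by linarith [ht.2], by linarith [ht.1]⟩).dist_le_mul x y).lipschitzOnWith)
    (fun t ht => (hrev hu t ht).continuousAt.continuousWithinAt)
    (fun t ht => (hrev hu t (Ico_subset_Icc_self ht)).hasDerivWithinAt) (fun _ _ => trivial)
    (fun t ht => (hrev hv t ht).continuousAt.continuousWithinAt)
    (fun t ht => (hrev hv t (Ico_subset_Icc_self ht)).hasDerivWithinAt) (fun _ _ => trivial)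
    (by simp) (-a) ⟨by linarith, le_rfl⟩
  simp only [neg_neg, Real.dist_eq] at this
  rw [mul_comm]
  convert this using 3
  ring

end RegularField

/-! ### Fences -/

/-- A function that decreases strictly whenever it equals `q` cannot rise above `q`. -/
theorem le_of_fence {u u' : ℝ → ℝ} {a b q : ℝ} (hab : a ≤ b)
    (hu : ∀ r ∈ Icc a b, HasDerivAt u (u' r) r) (ha : u a ≤ q)
    (hq : ∀ r ∈ Icc a b, u r = q → u' r < 0) : u b ≤ q :=
  image_le_of_deriv_right_lt_deriv_boundary (f := u) (f' := u') (B := fun _ => q) (B' := fun _ => 0)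
    (fun r hr => (hu r hr).continuousAt.continuousWithinAt)
    (fun r hr => (hu r (Ico_subset_Icc_self hr)).hasDerivWithinAt) ha (fun r => hasDerivAt_const r q)
    (fun r hr => hq r (Ico_subset_Icc_self hr)) ⟨hab, le_rfl⟩

theorem ge_of_fence {u u' : ℝ → ℝ} {a b q : ℝ} (hab : a ≤ b)
    (hu : ∀ r ∈ Icc a b, HasDerivAt u (u' r) r) (ha : q ≤ u a)
    (hq : ∀ r ∈ Icc a b, u r = q → 0 < u' r) : q ≤ u b := by
  have := le_of_fence (u := fun r => -u r) (u' := fun r => -u' r) (q := -q) hab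
    (fun r hr => (hu r hr).neg) (by linarith) (fun r hr h => by linarith [hq r hr (by linarith)])
  linarith

/-- If `|w|` starts below the barrier `B` and `(w ^ 2)' < (B ^ 2)'` whenever they meet, then `|w|`
stays below `B`. -/
theorem abs_le_of_fence {w w' B B' : ℝ → ℝ} {a b : ℝ} (hab : a ≤ b)
    (hw : ∀ r ∈ Icc a b, HasDerivAt w (w' r) r) (hB : ∀ r, HasDerivAt B (B' r) r)
    (hB0 : ∀ r, 0 ≤ B r) (ha : |w a| ≤ B a)
    (bound : ∀ r ∈ Icc a b, |w r| = B r → w r * w' r < B r * B' r) : |w b| ≤ B b := by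
  have hd : ∀ r ∈ Icc a b, HasDerivAt (fun r => w r ^ 2) (2 * (w r * w' r)) r := fun r hr => by
    have := (hw r hr).pow 2
    refine this.congr_deriv ?_
    push_cast; ring
  have := image_le_of_deriv_right_lt_deriv_boundary (f := fun r => w r ^ 2)
    (f' := fun r => 2 * (w r * w' r)) (B := fun r => B r ^ 2) (B' := fun r => 2 * (B r * B' r))
    (a := a) (b := b) (fun r hr => (hd r hr).continuousAt.continuousWithinAt)
    (fun r hr => (hd r (Ico_subset_Icc_self hr)).hasDerivWithinAt)
    (by rw [← sq_abs]; exact pow_le_pow_left₀ (abs_nonneg _) ha 2)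
    (fun r => ((hB r).pow 2).congr_deriv (by push_cast; ring))
    (fun r hr h => by
      have h1 : |w r| = B r := by rw [← abs_of_nonneg (hB0 r)]; exact sq_eq_sq_iff_abs_eq_abs _ _ |>.1 h
      linarith [bound r (Ico_subset_Icc_self hr) h1]) (⟨hab, le_rfl⟩ : b ∈ Icc a b)
  exact abs_le_of_sq_le_sq this (hB0 b)

/-- The fence lemma with the initial condition prescribed in the limit at the left end-point `0`. -/
theorem abs_le_of_fence_from_zero {w w' B B' : ℝ → ℝ} {T : ℝ}
    (hw : ∀ r ∈ Ioc 0 T, HasDerivAt w (w' r) r) (hB : ∀ r, HasDerivAt B (B' r) r)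
    (hB0 : ∀ r, 0 ≤ B r) (h0 : ∀ᶠ r in 𝓝[>] 0, |w r| ≤ B r)
    (bound : ∀ r ∈ Ioc 0 T, |w r| = B r → w r * w' r < B r * B' r) :
    ∀ r ∈ Ioc 0 T, |w r| ≤ B r := by
  intro r hr
  obtain ⟨a, ha, har⟩ := (h0.and (Ioo_mem_nhdsGT hr.1)).exists
  refine abs_le_of_fence har.2.le (fun s hs => hw s ⟨har.1.trans_le hs.1, hs.2.trans hr.2⟩) hB hB0 ha
    (fun s hs => bound s ⟨har.1.trans_le hs.1, hs.2.trans hr.2⟩)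

/-! ### Solutions issuing from the singular end-point -/

namespace IsSolutionFromZero

variable {F : ℝ → ℝ → ℝ} {l : ℝ} {u v : ℝ → ℝ}

theorem eventually_abs_sub_le (h : IsSolutionFromZero F l u) {ε : ℝ} (hε : 0 < ε) :
    ∀ᶠ r in 𝓝[>] 0, |u r - l| ≤ ε := by
  filter_upwards [h.2 (Metric.closedBall_mem_nhds l hε)] with r hr using hr

theorem eventually_abs_sub_solution_le (hu : IsSolutionFromZero F l u) {G : ℝ → ℝ → ℝ}
    (hv : IsSolutionFromZero G l v) {ε : ℝ} (hε : 0 < ε) : ∀ᶠ r in 𝓝[>] 0, |u r - v r| ≤ ε := by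
  filter_upwards [hu.eventually_abs_sub_le (half_pos hε), hv.eventually_abs_sub_le (half_pos hε)]
    with r h1 h2
  have : u r - v r = (u r - l) - (v r - l) := by ring
  rw [this]
  exact (abs_sub _ _).trans (by linarith)

end IsSolutionFromZero

/-- If `F r` is strictly decreasing near `l` for small `r`, then a solution is determined by its
limit `l` at `0`: the distance of two such solutions cannot grow. -/
theorem RegularField.eqOn_of_isSolutionFromZero {F : ℝ → ℝ → ℝ} (hF : RegularField F) {l η : ℝ}
    (hη : 0 < η)
    (hmono : ∀ᶠ r in 𝓝[>] 0, StrictAntiOn (F r) (Icc (l - η) (l + η)))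
    {u v : ℝ → ℝ} (hu : IsSolutionFromZero F l u) (hv : IsSolutionFromZero F l v) :
    EqOn v u (Ioi 0) := by
  have hev := hmono.and ((hu.eventually_abs_sub_le hη).and (hv.eventually_abs_sub_le hη))
  obtain ⟨T, hT, hTs⟩ := mem_nhdsGT_iff_exists_Ioc_subset.1 hev
  have hT : 0 < T := hT
  have key : ∀ ε > 0, |v T - u T| ≤ ε := fun ε hε => by
    refine abs_le_of_fence_from_zero (w := fun r => v r - u r) (B := fun _ => ε) (B' := fun _ => 0)
      (w' := fun r => F r (v r) - F r (u r)) (T := T)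
      (fun r hr => (hv.1 r hr.1).sub (hu.1 r hr.1)) (fun r => hasDerivAt_const r ε) (fun _ => hε.le)
      (hv.eventually_abs_sub_solution_le hu hε) (fun r hr h => ?_) T ⟨hT, le_rfl⟩
    obtain ⟨h1, h2, h3⟩ := hTs hr
    rw [abs_le] at h2 h3
    have hum : u r ∈ Icc (l - η) (l + η) := ⟨by linarith, by linarith⟩
    have hvm : v r ∈ Icc (l - η) (l + η) := ⟨by linarith, by linarith⟩
    simp only [mul_zero]
    rcases lt_trichotomy (v r) (u r) with h4 | h4 | h4
    · exact mul_neg_of_neg_of_pos (by linarith) (by linarith [h1 hvm hum h4])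
    · simp only [h4, sub_self, abs_zero] at h
      exact absurd h hε.ne
    · exact mul_neg_of_pos_of_neg (by linarith) (by linarith [h1 hum hvm h4])
  refine hF.eqOn_Ioi hT hv.1 hu.1 ?_
  have := le_of_forall_pos_le_add (a := |v T - u T|) (b := 0) (fun ε hε => by linarith [key ε hε])
  linarith [abs_nonpos_iff.1 this]

/-- If the field points inwards at `l ± ε` for all small `ε` and `r`, then some solution tends to
`l` at `0`. It is obtained as a limit of the solutions `u n` with `u n (1 / (n + 1)) = l`. -/
theorem RegularField.exists_isSolutionFromZero {F : ℝ → ℝ → ℝ} (hF : RegularField F) {l η : ℝ}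
    (hη : 0 < η)
    (hin : ∀ ε ∈ Ioc 0 η, ∀ᶠ r in 𝓝[>] 0, F r (l + ε) < 0 ∧ 0 < F r (l - ε)) :
    ∃ u, IsSolutionFromZero F l u := by
  have hin' : ∀ ε ∈ Ioc 0 η, ∃ T > 0, ∀ r ∈ Ioc 0 T, F r (l + ε) < 0 ∧ 0 < F r (l - ε) :=
    fun ε hε => mem_nhdsGT_iff_exists_Ioc_subset.1 (hin ε hε)
  choose w hw0 hw using fun n : ℕ =>
    hF.exists_solution (t₀ := 1 / ((n : ℝ) + 1)) (by positivity) l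
  have trap : ∀ ε ∈ Ioc 0 η, ∃ T > 0, ∀ r ∈ Ioc 0 T, ∀ n : ℕ, 1 / ((n : ℝ) + 1) ≤ r →
      |w n r - l| ≤ ε := fun ε hε => by
    obtain ⟨T, hT, h⟩ := hin' ε hε
    refine ⟨T, hT, fun r hr n hn => ?_⟩
    have hpos : 0 < 1 / ((n : ℝ) + 1) := by positivity
    have h1 := le_of_fence (q := l + ε) hn (fun s hs => hw n s (hpos.trans_le hs.1))
      (by rw [hw0 n]; linarith [hε.1])
      (fun s hs h' => by rw [h']; exact (h s ⟨hpos.trans_le hs.1, hs.2.trans hr.2⟩).1)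
    have h2 := ge_of_fence (q := l - ε) hn (fun s hs => hw n s (hpos.trans_le hs.1))
      (by rw [hw0 n]; linarith [hε.1])
      (fun s hs h' => by rw [h']; exact (h s ⟨hpos.trans_le hs.1, hs.2.trans hr.2⟩).2)
    exact abs_le.2 ⟨by linarith, by linarith⟩
  have hsmall : ∀ r : ℝ, 0 < r → ∀ᶠ n : ℕ in atTop, 1 / ((n : ℝ) + 1) ≤ r := fun r hr =>
    (tendsto_one_div_add_atTop_nhds_zero_nat.eventually (Iio_mem_nhds hr)).mono fun n hn => le_of_lt hn
  obtain ⟨T, hT, hTr⟩ := trap η ⟨hη, le_rfl⟩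
  obtain ⟨x, -, φ, hφ, hx⟩ := tendsto_subseq_of_frequently_bounded
    (Metric.isBounded_closedBall (x := l) (r := η)) (x := fun n => w n T)
    ((hsmall T hT).mono fun n hn => by
      simpa [Real.dist_eq] using hTr T ⟨hT, le_rfl⟩ n hn).frequently
  obtain ⟨u, huT, hu⟩ := hF.exists_solution hT x
  have hlim : ∀ r ∈ Ioc 0 T, Tendsto (fun n => w (φ n) r) atTop (𝓝 (u r)) := fun r hr => by
    obtain ⟨C, hC⟩ := hF.abs_sub_le_of_le (a := r) (b := T) hr.1
    rw [tendsto_iff_dist_tendsto_zero] at hx ⊢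
    refine squeeze_zero (fun _ => dist_nonneg) (fun n => ?_) (by simpa using hx.const_mul C)
    have := hC (w (φ n)) u (hw _) hu hr.2
    rw [huT] at this
    simpa [Real.dist_eq] using this
  refine ⟨u, hu, Metric.tendsto_nhds.2 fun ε hε => ?_⟩
  obtain ⟨S, hS, hSr⟩ := trap (min (ε / 2) η) ⟨lt_min (half_pos hε) hη, min_le_right _ _⟩
  filter_upwards [Ioc_mem_nhdsGT hS, Ioc_mem_nhdsGT hT] with r hr hr'
  have h1 : Tendsto (fun n => |w (φ n) r - l|) atTop (𝓝 |u r - l|) := ((hlim r hr').sub_const l).abs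
  have h2 : |u r - l| ≤ min (ε / 2) η := le_of_tendsto h1
    ((hφ.tendsto_atTop.eventually (hsmall r hr.1)).mono fun n hn => hSr r hr _ hn)
  rw [Real.dist_eq]
  linarith [min_le_left (ε / 2) η]

/-! ### Existence and uniqueness of the distinguished solutions -/

/-- A right-hand side which is a trigonometric polynomial in `2 x`; all the equations considered
here are of this form. -/
noncomputable def trigField (A B : ℝ → ℝ) (D : ℝ) (r x : ℝ) : ℝ :=
  A r + B r * sin (2 * x) + D * cos (2 * x)

theorem sin_two_mul_sub (x y : ℝ) :
    sin (2 * y) - sin (2 * x) = 2 * cos (x + y) * sin (y - x) := by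
  rw [sin_sub_sin]
  ring_nf

theorem cos_two_mul_sub (x y : ℝ) :
    cos (2 * y) - cos (2 * x) = -(2 * sin (x + y) * sin (y - x)) := by
  rw [cos_sub_cos]
  ring_nf

theorem trigField_sub (A B : ℝ → ℝ) (D r x y : ℝ) :
    trigField A B D r y - trigField A B D r x =
      2 * sin (y - x) * (B r * cos (x + y) - D * sin (x + y)) := by
  have h1 := sin_two_mul_sub x y
  have h2 := cos_two_mul_sub x y
  unfold trigField
  linear_combination B r * h1 + D * h2

theorem regularField_trigField {A B : ℝ → ℝ} (hA : ContinuousOn A (Ioi 0))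
    (hB : ContinuousOn B (Ioi 0)) (D : ℝ) : RegularField (trigField A B D) := by
  have bdd : ∀ {G : ℝ → ℝ}, ContinuousOn G (Ioi 0) → ∀ a b : ℝ, 0 < a →
      ∃ M : NNReal, ∀ r ∈ Icc a b, |G r| ≤ M := fun {G} hG a b ha => by
    obtain ⟨C, hC⟩ := isCompact_Icc.exists_bound_of_continuousOn
      (hG.mono fun r (hr : r ∈ Icc a b) => ha.trans_le hr.1)
    exact ⟨C.toNNReal, fun r hr => (hC r hr).trans (Real.le_coe_toNNReal C)⟩
  refine ⟨fun x => (hA.add (hB.mul_const _)).add_const _, fun a b ha => ?_, fun a b ha => ?_⟩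
  · obtain ⟨M, hM⟩ := bdd hB a b ha
    refine ⟨2 * M + 2 * ‖D‖₊, fun r hr => LipschitzWith.of_dist_le_mul fun x y => ?_⟩
    rw [Real.dist_eq, Real.dist_eq, trigField_sub, abs_mul, abs_mul]
    have h1 : |sin (x - y)| ≤ |x - y| := abs_sin_le_abs
    have h2 : |B r * cos (y + x) - D * sin (y + x)| ≤ M + |D| := by
      refine (abs_sub _ _).trans (add_le_add ?_ ?_)
      · rw [abs_mul]
        exact (mul_le_of_le_one_right (abs_nonneg _) (abs_cos_le_one _)).trans (hM r hr)
      · rw [abs_mul]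
        exact mul_le_of_le_one_right (abs_nonneg _) (abs_sin_le_one _)
    have h3 : |sin (x - y)| * |B r * cos (y + x) - D * sin (y + x)| ≤ |x - y| * (M + |D|) :=
      mul_le_mul h1 h2 (abs_nonneg _) (abs_nonneg _)
    push_cast
    rw [abs_of_pos (by norm_num : (0 : ℝ) < 2), Real.norm_eq_abs]
    linarith
  · obtain ⟨M, hM⟩ := bdd hA a b ha
    obtain ⟨N, hN⟩ := bdd hB a b ha
    refine ⟨M + N + ‖D‖₊, fun r hr x => ?_⟩
    push_cast
    rw [Real.norm_eq_abs]
    refine (abs_add_le _ _).trans (add_le_add ((abs_add_le _ _).trans (add_le_add (hM r hr) ?_)) ?_)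
    · rw [abs_mul]
      exact (mul_le_of_le_one_right (abs_nonneg _) (abs_sin_le_one _)).trans (hN r hr)
    · rw [abs_mul]
      exact mul_le_of_le_one_right (abs_nonneg _) (abs_cos_le_one _)

theorem strictAntiOn_trigField {A B : ℝ → ℝ} {D r l η : ℝ} (hη : η ≤ 1)
    (h : ∀ s, |s - 2 * l| ≤ 2 * η → B r * cos s - D * sin s < 0) :
    StrictAntiOn (trigField A B D r) (Icc (l - η) (l + η)) := by
  intro x hx y hy hxy
  have h1 : 0 < sin (y - x) :=
    sin_pos_of_pos_of_lt_pi (by linarith) (by linarith [hx.1, hy.2, pi_gt_three])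
  have h2 := h (x + y) (abs_le.2 ⟨by linarith [hx.1, hy.1], by linarith [hx.2, hy.2]⟩)
  have h3 := trigField_sub A B D r x y
  nlinarith [mul_pos h1 (neg_pos.2 h2)]

theorem eventually_neg_of_continuous {f : ℝ → ℝ} (hf : Continuous f) (h : f 0 < 0) :
    ∀ᶠ r in 𝓝[>] 0, f r < 0 :=
  (hf.continuousAt.eventually (Iio_mem_nhds h)).filter_mono nhdsWithin_le_nhds

theorem sin_two_mul_angleAtZero {α : ℝ} (hα : α = 1 ∨ α = -1) : sin (2 * angleAtZero α) = 0 := by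
  rcases hα with rfl | rfl
  · rw [angleAtZero, if_pos rfl, mul_div_cancel₀ _ two_ne_zero, sin_pi]
  · rw [angleAtZero, if_neg (by norm_num), sin_two_pi]

theorem cos_two_mul_angleAtZero {α : ℝ} (hα : α = 1 ∨ α = -1) : cos (2 * angleAtZero α) = -α := by
  rcases hα with rfl | rfl
  · rw [angleAtZero, if_pos rfl, mul_div_cancel₀ _ two_ne_zero, cos_pi]
  · rw [angleAtZero, if_neg (by norm_num), cos_two_pi, neg_neg]

/-- Near the initial angle, the singular term of the Prüfer equation is contracting. -/
theorem mul_cos_le_of_abs_sub_le {α s : ℝ} (hα : α = 1 ∨ α = -1)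
    (hs : |s - 2 * angleAtZero α| ≤ 1) : α * cos s ≤ -(1 / 2) := by
  have h1 : cos s = -α * cos (s - 2 * angleAtZero α) := by
    have := cos_add (2 * angleAtZero α) (s - 2 * angleAtZero α)
    rw [sin_two_mul_angleAtZero hα, cos_two_mul_angleAtZero hα] at this
    rw [← sub_zero (-α * _), ← zero_mul (sin (s - 2 * angleAtZero α)), ← this]
    ring_nf
  have h2 : 1 / 2 ≤ cos (s - 2 * angleAtZero α) := by
    have := cos_le_cos_of_nonneg_of_le_pi (abs_nonneg (s - 2 * angleAtZero α))
      (by linarith [pi_gt_three]) hs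
    rw [cos_abs] at this
    linarith [cos_one_pos, Real.one_sub_sq_div_two_le_cos (x := 1)]
  have h3 : α * α = 1 := by rcases hα with rfl | rfl <;> norm_num
  rw [h1, show α * (-α * cos (s - 2 * angleAtZero α)) = -(α * α * cos (s - 2 * angleAtZero α)) by
    ring, h3]
  linarith

theorem prueferField_eq_trigField (k α μ c a lam : ℝ) : prueferField k α μ c a lam =
    trigField (fun r => c / r - lam) (fun r => k / r + α * |a| / r ^ 2) μ := by
  ext r x
  simp only [prueferField, trigField]
  ring

theorem coulombField_eq_trigField (k μ c lam : ℝ) : coulombField k μ c lam =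
    trigField (fun r => c / r - lam) (fun r => k / r) μ := by
  ext r x
  simp only [coulombField, trigField]
  ring

/-- The simplified equation is the Prüfer equation with `|a| = 1` and without the terms that are
regular at `0`. -/
theorem simplifiedField_eq_prueferField (k α c : ℝ) :
    simplifiedField k α c = prueferField k α 0 c (-1) 0 := by
  ext r x
  simp only [simplifiedField, prueferField, abs_neg, abs_one]
  rcases eq_or_ne r 0 with rfl | hr
  · simp
  · field_simp
    ring

theorem continuousOn_const_div_pow (x : ℝ) (n : ℕ) : ContinuousOn (fun r : ℝ => x / r ^ n) (Ioi 0) :=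
  continuousOn_const.div (continuousOn_id.pow n) fun _ hr => pow_ne_zero n (ne_of_gt hr)

theorem continuousOn_const_div (x : ℝ) : ContinuousOn (fun r : ℝ => x / r) (Ioi 0) := by
  simpa using continuousOn_const_div_pow x 1

theorem hasUniqueSolutionFromZero_prueferField (k μ c lam : ℝ) {α a : ℝ} (hα : α = 1 ∨ α = -1)
    (ha : a ≠ 0) : HasUniqueSolutionFromZero (prueferField k α μ c a lam) (angleAtZero α) := by
  have ha' : 0 < |a| := abs_pos.2 ha
  have hα2 : α * α = 1 := by rcases hα with rfl | rfl <;> norm_num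
  have hreg : RegularField (prueferField k α μ c a lam) := by
    rw [prueferField_eq_trigField]
    exact regularField_trigField ((continuousOn_const_div c).sub continuousOn_const)
      ((continuousOn_const_div k).add (continuousOn_const_div_pow _ 2)) μ
  have hpos : ∀ᶠ r : ℝ in 𝓝[>] 0, 0 < r := self_mem_nhdsWithin
  have hex : ∃ u, IsSolutionFromZero (prueferField k α μ c a lam) (angleAtZero α) u := by
    refine hreg.exists_isSolutionFromZero one_pos fun ε hε => ?_
    have hsin : 0 < sin (2 * ε) :=
      sin_pos_of_pos_of_lt_pi (by linarith [hε.1]) (by linarith [hε.2, pi_gt_three])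
    -- `r ^ 2` times the field at `l ± ε` extends continuously to `r = 0`, with the value
    -- `∓ |a| sin 2ε`
    have h1 : ∀ᶠ r : ℝ in 𝓝[>] 0, c * r + (k * r + α * |a|) * (-α * sin (2 * ε)) +
        r ^ 2 * (μ * cos (2 * (angleAtZero α + ε)) - lam) < 0 :=
      eventually_neg_of_continuous (by fun_prop) (by
        simp only [mul_zero, zero_add, ne_eq, OfNat.ofNat_ne_zero, not_false_eq_true, zero_pow,
          zero_mul, add_zero]
        rw [show α * |a| * (-α * sin (2 * ε)) = -(α * α * (|a| * sin (2 * ε))) by ring, hα2]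
        linarith [mul_pos ha' hsin])
    have h2 : ∀ᶠ r : ℝ in 𝓝[>] 0, -(c * r + (k * r + α * |a|) * (α * sin (2 * ε)) +
        r ^ 2 * (μ * cos (2 * (angleAtZero α - ε)) - lam)) < 0 :=
      eventually_neg_of_continuous (by fun_prop) (by
        simp only [mul_zero, zero_add, ne_eq, OfNat.ofNat_ne_zero, not_false_eq_true, zero_pow,
          zero_mul, add_zero]
        rw [show α * |a| * (α * sin (2 * ε)) = α * α * (|a| * sin (2 * ε)) by ring, hα2]
        linarith [mul_pos ha' hsin])
    filter_upwards [h1, h2, hpos] with r h1 h2 hr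
    have e1 : sin (2 * (angleAtZero α + ε)) = -α * sin (2 * ε) := by
      rw [mul_add, sin_add, sin_two_mul_angleAtZero hα, cos_two_mul_angleAtZero hα]; ring
    have e2 : sin (2 * (angleAtZero α - ε)) = α * sin (2 * ε) := by
      rw [mul_sub, sin_sub, sin_two_mul_angleAtZero hα, cos_two_mul_angleAtZero hα]; ring
    have hr2 : 0 < r ^ 2 := by positivity
    constructor
    · refine neg_of_mul_neg_right (a := r ^ 2) ?_ hr2.le
      rw [prueferField, e1]
      have e3 : r ^ 2 * (c / r + (k / r + α * |a| / r ^ 2) * (-α * sin (2 * ε)) +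
          μ * cos (2 * (angleAtZero α + ε)) - lam) =
          c * r + (k * r + α * |a|) * (-α * sin (2 * ε)) +
            r ^ 2 * (μ * cos (2 * (angleAtZero α + ε)) - lam) := by
        field_simp
        ring
      linarith
    · refine pos_of_mul_pos_right (a := r ^ 2) ?_ hr2.le
      rw [prueferField, e2]
      have e3 : r ^ 2 * (c / r + (k / r + α * |a| / r ^ 2) * (α * sin (2 * ε)) +
          μ * cos (2 * (angleAtZero α - ε)) - lam) =
          c * r + (k * r + α * |a|) * (α * sin (2 * ε)) +
            r ^ 2 * (μ * cos (2 * (angleAtZero α - ε)) - lam) := by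
        field_simp
        ring
      linarith
  obtain ⟨u, hu⟩ := hex
  refine ⟨u, hu, fun v hv => hreg.eqOn_of_isSolutionFromZero (η := 1 / 2) (by norm_num) ?_ hu hv⟩
  have h1 : ∀ᶠ r : ℝ in 𝓝[>] 0, |k| * r - |a| / 2 + |μ| * r ^ 2 < 0 :=
    eventually_neg_of_continuous (by fun_prop) (by simpa using ha')
  filter_upwards [h1, hpos] with r h1 hr
  rw [prueferField_eq_trigField]
  refine strictAntiOn_trigField (by norm_num) fun s hs => ?_
  have h2 := mul_cos_le_of_abs_sub_le hα (hs.trans (by norm_num))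
  have h3 : k * cos s ≤ |k| := (le_abs_self _).trans (by
    rw [abs_mul]; exact mul_le_of_le_one_right (abs_nonneg _) (abs_cos_le_one _))
  have h4 : -(μ * sin s) ≤ |μ| := (neg_le_abs _).trans (by
    rw [abs_mul]; exact mul_le_of_le_one_right (abs_nonneg _) (abs_sin_le_one _))
  have hr2 : 0 < r ^ 2 := by positivity
  refine neg_of_mul_neg_right (a := r ^ 2) ?_ hr2.le
  have : r ^ 2 * ((k / r + α * |a| / r ^ 2) * cos s - μ * sin s) =
      r * (k * cos s) + |a| * (α * cos s) + r ^ 2 * -(μ * sin s) := by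
    field_simp
    ring
  rw [this]
  have h5 := mul_le_mul_of_nonneg_left h3 hr.le
  have h6 := mul_le_mul_of_nonneg_left h2 ha'.le
  have h7 := mul_le_mul_of_nonneg_left h4 hr2.le
  linarith

theorem hasUniqueSolutionFromZero_simplifiedField (k c : ℝ) {α : ℝ} (hα : α = 1 ∨ α = -1) :
    HasUniqueSolutionFromZero (simplifiedField k α c) (angleAtZero α) := by
  rw [simplifiedField_eq_prueferField]
  exact hasUniqueSolutionFromZero_prueferField k 0 c 0 hα (by norm_num)

/-- `tan ϑ₊(c)` is a root of the quadratic equation `c t² + 2 k t + c = 0`, which expresses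
`k sin 2ϑ = -c`. -/
theorem two_mul_div_one_add_sq_of_root {k c t : ℝ} (hk : 0 < k)
    (h : c * t ^ 2 + 2 * k * t + c = 0) : 2 * t / (1 + t ^ 2) = -c / k := by
  rw [div_eq_div_iff (by positivity) hk.ne']
  linear_combination h

theorem sin_two_mul_arctan (t : ℝ) : sin (2 * arctan t) = 2 * t / (1 + t ^ 2) := by
  rw [sin_two_mul, sin_arctan, cos_arctan]
  have h : √(1 + t ^ 2) * √(1 + t ^ 2) = 1 + t ^ 2 := Real.mul_self_sqrt (by positivity)
  rw [mul_assoc, div_mul_div_comm, mul_one, h, mul_div_assoc]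

section thetaPlus

variable {k c : ℝ}

theorem mul_sin_two_mul_thetaPlus (hc : c ∈ Ioo (-k) 0) : k * sin (2 * thetaPlus k c) = -c := by
  have hk : 0 < k := by linarith [hc.1, hc.2]
  have hs : √(k ^ 2 - c ^ 2) ^ 2 = k ^ 2 - c ^ 2 :=
    Real.sq_sqrt (by nlinarith [hc.1, hc.2])
  have hc0 : c ≠ 0 := hc.2.ne
  rw [thetaPlus, sin_two_mul_arctan, two_mul_div_one_add_sq_of_root hk, mul_div_cancel₀ _ hk.ne']
  field_simp
  linear_combination hs

theorem thetaMinus_eq (hc : c ∈ Ioo (-k) 0) : thetaMinus k c = π / 2 - thetaPlus k c := by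
  have hk : 0 < k := by linarith [hc.1, hc.2]
  have hs : √(k ^ 2 - c ^ 2) ^ 2 = k ^ 2 - c ^ 2 :=
    Real.sq_sqrt (by nlinarith [hc.1, hc.2])
  have hpos : 0 < (k + √(k ^ 2 - c ^ 2)) / (-c) :=
    div_pos (by positivity) (by linarith [hc.2])
  rw [thetaMinus, thetaPlus, ← arctan_inv_of_pos hpos, inv_div]
  congr 1
  have h1 : k + √(k ^ 2 - c ^ 2) ≠ 0 := by positivity
  have hc0 : -c ≠ 0 := by linarith [hc.2]
  rw [div_eq_div_iff hc0 h1]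
  linear_combination -hs

theorem thetaPlus_mem (hc : c ∈ Ioo (-k) 0) : thetaPlus k c ∈ Ioo (π / 4) (π / 2) := by
  refine ⟨?_, arctan_lt_pi_div_two _⟩
  rw [← arctan_one, thetaPlus]
  refine arctan_strictMono ?_
  rw [one_lt_div (by linarith [hc.2])]
  linarith [hc.1, Real.sqrt_nonneg (k ^ 2 - c ^ 2)]

theorem cos_two_mul_thetaPlus_neg (hc : c ∈ Ioo (-k) 0) : cos (2 * thetaPlus k c) < 0 := by
  have := thetaPlus_mem hc
  exact cos_neg_of_pi_div_two_lt_of_lt (by linarith [this.1]) (by linarith [this.2, pi_pos])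

theorem add_mul_sin_eq (hc : c ∈ Ioo (-k) 0) (x : ℝ) : c + k * sin (2 * x) =
    2 * k * cos (x + thetaPlus k c) * sin (x - thetaPlus k c) := by
  have h1 := mul_sin_two_mul_thetaPlus hc
  have h2 := sin_two_mul_sub (thetaPlus k c) x
  rw [add_comm x]
  linear_combination k * h2 + h1

theorem exists_cos_le_near_thetaPlus (hc : c ∈ Ioo (-k) 0) :
    ∃ κ > 0, ∃ η > 0, η ≤ 1 ∧ ∀ s, |s - 2 * thetaPlus k c| ≤ 3 * η → cos s ≤ -κ := by
  have h := cos_two_mul_thetaPlus_neg hc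
  have h2 : ∀ᶠ s in 𝓝 (2 * thetaPlus k c), cos s ≤ -(-cos (2 * thetaPlus k c) / 2) :=
    (continuous_cos.continuousAt.eventually (Iio_mem_nhds
      (show cos (2 * thetaPlus k c) < -(-cos (2 * thetaPlus k c) / 2) by linarith))).mono
      fun s hs => le_of_lt hs
  obtain ⟨δ, hδ, hδs⟩ := Metric.nhds_basis_closedBall.eventually_iff.1 h2
  refine ⟨_, by linarith, min (δ / 3) 1, by positivity, min_le_right _ _, fun s hs => hδs ?_⟩
  rw [Metric.mem_closedBall, Real.dist_eq]
  linarith [min_le_left (δ / 3) 1]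

end thetaPlus

theorem hasUniqueSolutionFromZero_coulombField (μ lam : ℝ) {k c : ℝ} (hc : c ∈ Ioo (-k) 0) :
    HasUniqueSolutionFromZero (coulombField k μ c lam) (thetaPlus k c) := by
  have hk : 0 < k := by linarith [hc.1, hc.2]
  obtain ⟨κ, hκ, η, hη, hη1, hcos⟩ := exists_cos_le_near_thetaPlus hc
  have hreg : RegularField (coulombField k μ c lam) := by
    rw [coulombField_eq_trigField]
    exact regularField_trigField ((continuousOn_const_div c).sub continuousOn_const)
      (continuousOn_const_div k) μ
  have hpos : ∀ᶠ r : ℝ in 𝓝[>] 0, 0 < r := self_mem_nhdsWithin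
  have hex : ∃ u, IsSolutionFromZero (coulombField k μ c lam) (thetaPlus k c) u := by
    refine hreg.exists_isSolutionFromZero hη fun ε hε => ?_
    have hsin : 0 < sin ε :=
      sin_pos_of_pos_of_lt_pi hε.1 (by linarith [hε.2, pi_gt_three])
    have e1 : c + k * sin (2 * (thetaPlus k c + ε)) < 0 := by
      have := hcos (thetaPlus k c + ε + thetaPlus k c) (by
        rw [show thetaPlus k c + ε + thetaPlus k c - 2 * thetaPlus k c = ε by ring,
          abs_of_pos hε.1]
        linarith [hε.2])
      rw [add_mul_sin_eq hc, add_sub_cancel_left]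
      exact mul_neg_of_neg_of_pos (mul_neg_of_pos_of_neg (by linarith) (by linarith)) hsin
    have e2 : -(c + k * sin (2 * (thetaPlus k c - ε))) < 0 := by
      have := hcos (thetaPlus k c - ε + thetaPlus k c) (by
        rw [show thetaPlus k c - ε + thetaPlus k c - 2 * thetaPlus k c = -ε by ring, abs_neg,
          abs_of_pos hε.1]
        linarith [hε.2])
      rw [add_mul_sin_eq hc, sub_sub_cancel_left, sin_neg, mul_neg, neg_neg]
      exact mul_neg_of_neg_of_pos (mul_neg_of_pos_of_neg (by linarith) (by linarith)) hsin
    have h1 : ∀ᶠ r : ℝ in 𝓝[>] 0, c + k * sin (2 * (thetaPlus k c + ε)) +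
        r * (μ * cos (2 * (thetaPlus k c + ε)) - lam) < 0 :=
      eventually_neg_of_continuous (by fun_prop) (by simpa using e1)
    have h2 : ∀ᶠ r : ℝ in 𝓝[>] 0, -(c + k * sin (2 * (thetaPlus k c - ε))) -
        r * (μ * cos (2 * (thetaPlus k c - ε)) - lam) < 0 :=
      eventually_neg_of_continuous (by fun_prop) (by simpa using e2)
    filter_upwards [h1, h2, hpos] with r h1 h2 hr
    constructor
    · refine neg_of_mul_neg_right (a := r) ?_ hr.le
      have : r * coulombField k μ c lam r (thetaPlus k c + ε) =
          c + k * sin (2 * (thetaPlus k c + ε)) +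
            r * (μ * cos (2 * (thetaPlus k c + ε)) - lam) := by
        rw [coulombField]
        field_simp
        ring
      rwa [this]
    · refine pos_of_mul_pos_right (a := r) ?_ hr.le
      have : r * coulombField k μ c lam r (thetaPlus k c - ε) =
          c + k * sin (2 * (thetaPlus k c - ε)) +
            r * (μ * cos (2 * (thetaPlus k c - ε)) - lam) := by
        rw [coulombField]
        field_simp
        ring
      linarith
  obtain ⟨u, hu⟩ := hex
  refine ⟨u, hu, fun v hv => hreg.eqOn_of_isSolutionFromZero hη ?_ hu hv⟩
  have h1 : ∀ᶠ r : ℝ in 𝓝[>] 0, -(k * κ) + |μ| * r < 0 :=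
    eventually_neg_of_continuous (by fun_prop) (by simpa using mul_pos hk hκ)
  filter_upwards [h1, hpos] with r h1 hr
  rw [coulombField_eq_trigField]
  refine strictAntiOn_trigField hη1 fun s hs => ?_
  have h2 := mul_le_mul_of_nonneg_left (hcos s (hs.trans (by linarith))) hk.le
  have h4 : -(μ * sin s) ≤ |μ| := (neg_le_abs _).trans (by
    rw [abs_mul]; exact mul_le_of_le_one_right (abs_nonneg _) (abs_sin_le_one _))
  refine neg_of_mul_neg_right (a := r) ?_ hr.le
  have : r * (k / r * cos s - μ * sin s) = k * cos s + r * -(μ * sin s) := by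
    field_simp
    ring
  rw [this]
  nlinarith [mul_le_mul_of_nonneg_left h4 hr.le]

theorem HasUniqueSolutionFromZero.isSolutionFromZero {F : ℝ → ℝ → ℝ} {l : ℝ}
    (h : HasUniqueSolutionFromZero F l) : IsSolutionFromZero F l (solutionFromZero F l) :=
  Classical.epsilon_spec (h.imp fun _ hu => hu.1)

theorem HasUniqueSolutionFromZero.eq {F : ℝ → ℝ → ℝ} {l : ℝ} (h : HasUniqueSolutionFromZero F l)
    {u v : ℝ → ℝ} (hu : IsSolutionFromZero F l u) (hv : IsSolutionFromZero F l v) {r : ℝ}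
    (hr : 0 < r) : u r = v r := by
  obtain ⟨w, -, hw⟩ := h
  rw [hw u hu hr, hw v hv hr]

/-! ### Stability of the simplified equation on bounded intervals -/

theorem sq_half_le_mul_sin {w : ℝ} (hw : |w| ≤ 1) : w ^ 2 / 2 ≤ w * sin w := by
  have key : ∀ x : ℝ, 0 < x → x ≤ 1 → x ^ 2 / 2 ≤ x * sin x := fun x h0 h1 => by
    have h2 := sin_gt_sub_cube h0
    have h3 : x ^ 2 ≤ 1 := by nlinarith
    nlinarith
  rcases lt_trichotomy w 0 with h | rfl | h
  · have := key (-w) (by linarith) (by rw [← abs_of_neg h]; exact hw)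
    rw [sin_neg] at this
    nlinarith
  · simp
  · exact key w h (by rwa [abs_of_pos h] at hw)

theorem mul_sin_nonneg {w : ℝ} (hw : |w| ≤ 1) : 0 ≤ w * sin w :=
  le_trans (by positivity) (sq_half_le_mul_sin hw)

theorem mul_sin_le_sq (w : ℝ) : w * sin w ≤ w ^ 2 := by
  have h1 : |w * sin w| ≤ |w| * |w| := by
    rw [abs_mul]; exact mul_le_mul_of_nonneg_left abs_sin_le_abs (abs_nonneg w)
  rw [abs_mul_abs_self] at h1
  nlinarith [le_abs_self (w * sin w)]

/-- Solutions with the distinguished limit at `0` depend continuously on the right-hand side: the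
contraction near `0` beats the perturbation there, and the exponential barrier controls its growth
afterwards. -/
theorem exists_forall_abs_sub_le_of_perturbation {k α c : ℝ} (hk : 0 < k)
    (hα : α = 1 ∨ α = -1) {v : ℝ → ℝ}
    (hv : IsSolutionFromZero (simplifiedField k α c) (angleAtZero α) v) {T η : ℝ} (hT : 0 < T)
    (hη : 0 < η) :
    ∃ ε > 0, ∀ u g : ℝ → ℝ,
      (∀ ρ ∈ Ioc 0 T, HasDerivAt u ((c + (k + α / ρ) * sin (2 * u ρ) + g ρ) / ρ) ρ) →
      (∀ ρ ∈ Ioc 0 T, |g ρ| ≤ ε) → Tendsto u (𝓝[>] 0) (𝓝 (angleAtZero α)) →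
      |u T - v T| ≤ η := by
  have hα1 : |α| = 1 := by rcases hα with rfl | rfl <;> simp
  obtain ⟨δ₀, hδ₀, hvδ⟩ := mem_nhdsGT_iff_exists_Ioc_subset.1
    (hv.eventually_abs_sub_le (ε := 1 / 10) (by norm_num))
  have hδ₀ : 0 < δ₀ := hδ₀
  set δ := min δ₀ (1 / (2 * k + 1)) with hδdef
  have hδ : 0 < δ := lt_min hδ₀ (by positivity)
  set M := (2 * (k + 1 / δ) + 1) / δ + 1 with hMdef
  have hM : 0 < M := by positivity
  set σ := min (1 / 10) η * exp (-(M * T)) with hσdef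
  have hσ : 0 < σ := by positivity
  have hBT : ∀ ρ ≤ T, σ * exp (M * ρ) ≤ min (1 / 10) η := fun ρ hρ => by
    rw [hσdef, mul_assoc, ← exp_add]
    refine mul_le_of_le_one_right (by positivity) (exp_le_one_iff.2 ?_)
    nlinarith
  refine ⟨σ / 4, by positivity, fun u g hu hg hu0 => ?_⟩
  refine le_trans ?_ ((hBT T le_rfl).trans (min_le_right _ _))
  refine abs_le_of_fence_from_zero (w := fun ρ => u ρ - v ρ) (B := fun ρ => σ * exp (M * ρ))
    (B' := fun ρ => σ * (exp (M * ρ) * M))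
    (fun ρ hρ => (hu ρ hρ).sub (hv.1 ρ hρ.1)) (fun ρ => ?_) (fun ρ => by positivity) ?_
    (fun ρ hρ hw => ?_) T ⟨hT, le_rfl⟩
  · have := ((hasDerivAt_id ρ).const_mul M).exp.const_mul σ
    simpa using this
  · have h1 : Tendsto (fun ρ => u ρ - v ρ) (𝓝[>] 0) (𝓝 0) := by
      simpa using hu0.sub hv.2
    filter_upwards [h1 (Metric.closedBall_mem_nhds 0 hσ), self_mem_nhdsWithin] with ρ h2 h3
    have h3 : 0 < ρ := h3
    have h4 : |u ρ - v ρ| ≤ σ := by simpa using h2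
    exact h4.trans (le_mul_of_one_le_right hσ.le (one_le_exp (by positivity)))
  · have hρ0 : 0 < ρ := hρ.1
    set w := u ρ - v ρ with hwdef
    set B := σ * exp (M * ρ) with hBdef
    have hB : 0 < B := by positivity
    have hσB : σ ≤ B := le_mul_of_one_le_right hσ.le (one_le_exp (by positivity))
    have hB1 : B ≤ 1 / 10 := (hBT ρ hρ.2).trans (min_le_left _ _)
    have hw1 : |w| ≤ 1 := by linarith
    have hw2 : w ^ 2 = B ^ 2 := by rw [← sq_abs, hw]
    have hgw : w * g ρ ≤ B * (σ / 4) := by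
      refine (le_abs_self _).trans ?_
      rw [abs_mul, hw]
      exact mul_le_mul_of_nonneg_left (hg ρ hρ) hB.le
    have hrw : w * ((c + (k + α / ρ) * sin (2 * u ρ) + g ρ) / ρ -
        simplifiedField k α c ρ (v ρ)) =
        (2 * ((k + α / ρ) * cos (v ρ + u ρ)) * (w * sin w) + w * g ρ) / ρ := by
      rw [simplifiedField, ← sub_div, ← mul_div_assoc]
      congr 1
      linear_combination w * (k + α / ρ) * sin_two_mul_sub (v ρ) (u ρ)
    rw [hrw, div_lt_iff₀ hρ0]
    rcases le_total ρ δ with h | h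
    · have h1 : |v ρ - angleAtZero α| ≤ 1 / 10 := hvδ ⟨hρ0, h.trans (min_le_left _ _)⟩
      have h2 : α * cos (v ρ + u ρ) ≤ -(1 / 2) := by
        refine mul_cos_le_of_abs_sub_le hα ?_
        have : v ρ + u ρ - 2 * angleAtZero α = 2 * (v ρ - angleAtZero α) + w := by
          rw [hwdef]; ring
        rw [this]
        refine (abs_add_le _ _).trans ?_
        rw [abs_mul, abs_two]
        linarith
      have h3 : 2 * k + 1 ≤ 1 / ρ := by
        rw [le_one_div (by positivity) hρ0]
        exact h.trans (min_le_right _ _)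
      have h4 : (k + α / ρ) * cos (v ρ + u ρ) ≤ -(1 / 2) := by
        have e : (k + α / ρ) * cos (v ρ + u ρ) =
            k * cos (v ρ + u ρ) + (1 / ρ) * (α * cos (v ρ + u ρ)) := by ring
        have h5 : k * cos (v ρ + u ρ) ≤ k := mul_le_of_le_one_right hk.le (cos_le_one _)
        have h6 : (1 / ρ) * (α * cos (v ρ + u ρ)) ≤ (1 / ρ) * (-(1 / 2)) :=
          mul_le_mul_of_nonneg_left h2 (by positivity)
        linarith
      have h7 := sq_half_le_mul_sin hw1
      have h8 : 0 < B * (σ * (exp (M * ρ) * M)) * ρ := by positivity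
      have h9 : ((k + α / ρ) * cos (v ρ + u ρ)) * (w * sin w) ≤ -(1 / 2) * (w * sin w) :=
        mul_le_mul_of_nonneg_right h4 (mul_sin_nonneg hw1)
      nlinarith
    · have h4 : (k + α / ρ) * cos (v ρ + u ρ) ≤ k + 1 / δ := by
        refine (le_abs_self _).trans ?_
        rw [abs_mul]
        refine (mul_le_of_le_one_right (abs_nonneg _) (abs_cos_le_one _)).trans ?_
        refine (abs_add_le _ _).trans ?_
        rw [abs_of_pos hk, abs_div, hα1, abs_of_pos hρ0]
        gcongr
      have h5 : (k + α / ρ) * cos (v ρ + u ρ) * (w * sin w) ≤ (k + 1 / δ) * B ^ 2 := by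
        refine (mul_le_mul_of_nonneg_right h4 (mul_sin_nonneg hw1)).trans ?_
        rw [← hw2]
        exact mul_le_mul_of_nonneg_left (mul_sin_le_sq w) (by positivity)
      have h6 : B * (σ * (exp (M * ρ) * M)) * ρ = B ^ 2 * (M * ρ) := by rw [hBdef]; ring
      have h7 : 2 * (k + 1 / δ) + 1 < M * ρ := by
        have : M * δ = 2 * (k + 1 / δ) + 1 + δ := by
          rw [hMdef, add_mul, div_mul_cancel₀ _ hδ.ne']; ring
        nlinarith
      rw [h6]
      have h8 : B * (σ / 4) ≤ B ^ 2 := by nlinarith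
      linarith [mul_lt_mul_of_pos_left h7 (pow_pos hB 2)]

/-! ### Asymptotics of the simplified equation at infinity -/

/-- If `ρ u'` is bounded below by a positive constant as long as `u ≤ q`, then `u` reaches `q`,
because `∫ dρ / ρ` diverges at infinity, and stays above it from then on. -/
theorem eventually_ge_of_drift {u u' : ℝ → ℝ} {q κ ρ₀ : ℝ} (hρ₀ : 0 < ρ₀) (hκ : 0 < κ)
    (hu : ∀ ρ, ρ₀ ≤ ρ → HasDerivAt u (u' ρ) ρ)
    (hd : ∀ ρ, ρ₀ ≤ ρ → u ρ ≤ q → κ / ρ ≤ u' ρ) : ∀ᶠ ρ in atTop, q ≤ u ρ := by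
  obtain ⟨s, hs, hqs⟩ : ∃ s, ρ₀ ≤ s ∧ q ≤ u s := by
    by_contra! hcon
    have hmono : MonotoneOn (fun ρ => u ρ - κ * log ρ) (Ici ρ₀) := by
      have hder : ∀ ρ ∈ Ici ρ₀, HasDerivAt (fun ρ => u ρ - κ * log ρ) (u' ρ - κ * ρ⁻¹) ρ :=
        fun ρ hρ => (hu ρ hρ).sub
          ((hasDerivAt_log (hρ₀.trans_le hρ).ne').const_mul κ)
      refine monotoneOn_of_hasDerivWithinAt_nonneg (convex_Ici ρ₀)
        (f' := fun ρ => u' ρ - κ * ρ⁻¹) (fun ρ hρ => (hder ρ hρ).continuousAt.continuousWithinAt)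
        (fun ρ hρ => (hder ρ (interior_subset hρ)).hasDerivWithinAt) (fun ρ hρ => ?_)
      have hρ : ρ₀ ≤ ρ := interior_subset hρ
      have := hd ρ hρ (hcon ρ hρ).le
      rw [div_eq_mul_inv] at this
      linarith
    have hlog : Tendsto (fun ρ => κ * log ρ) atTop atTop := tendsto_log_atTop.const_mul_atTop hκ
    obtain ⟨ρ, h1, h2⟩ := ((hlog.eventually_ge_atTop (q - (u ρ₀ - κ * log ρ₀))).and
      (eventually_ge_atTop ρ₀)).exists
    have h3 := hmono (self_mem_Ici (a := ρ₀)) h2 h2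
    have h4 := hcon ρ h2
    simp only at h3
    linarith
  filter_upwards [eventually_ge_atTop s] with ρ hρ
  refine ge_of_fence hρ (fun r hr => hu r (hs.trans hr.1)) hqs (fun r hr h => ?_)
  exact lt_of_lt_of_le (div_pos hκ (hρ₀.trans_le (hs.trans hr.1))) (hd r (hs.trans hr.1) h.le)

/-- `u` solves the simplified equation on `(0, ∞)`, with no condition at `0`. -/
def IsSimplifiedSolution (k α c : ℝ) (u : ℝ → ℝ) : Prop :=
  ∀ ρ : ℝ, 0 < ρ → HasDerivAt u (simplifiedField k α c ρ (u ρ)) ρ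

namespace IsSimplifiedSolution

variable {k α c : ℝ} {u : ℝ → ℝ}

theorem neg (hu : IsSimplifiedSolution k α c u) : IsSimplifiedSolution k α (-c) (fun ρ => -u ρ) :=
  fun ρ hρ => (hu ρ hρ).neg.congr_deriv (by
    simp only [simplifiedField, mul_neg, sin_neg]; ring)

theorem add_nat_mul_pi (hu : IsSimplifiedSolution k α c u) (m : ℕ) :
    IsSimplifiedSolution k α c (fun ρ => u ρ + m * π) :=
  fun ρ hρ => ((hu ρ hρ).add_const _).congr_deriv (by
    have : 2 * (u ρ + m * π) = 2 * u ρ + m * (2 * π) := by ring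
    simp only [simplifiedField, this, sin_add_nat_mul_two_pi])

theorem eventually_ge (hu : IsSimplifiedSolution k α c u) {b q : ℝ}
    (hb : ∀ᶠ ρ in atTop, b ≤ u ρ) (hpos : ∀ x ∈ Icc b q, 0 < c + k * sin (2 * x)) :
    ∀ᶠ ρ in atTop, q ≤ u ρ := by
  obtain ⟨κ, hκ, hκx⟩ := isCompact_Icc.exists_forall_le' (s := Icc b q)
    (f := fun x => c + k * sin (2 * x)) (a := 0) (by fun_prop) hpos
  have h1 : Tendsto (fun ρ : ℝ => |α| / ρ) atTop (𝓝 0) := tendsto_const_nhds.div_atTop tendsto_id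
  obtain ⟨ρ₀, hρ₀⟩ := eventually_atTop.1 ((hb.and (h1.eventually (Iio_mem_nhds (half_pos hκ)))).and
    (eventually_gt_atTop 0))
  have hρ₀0 : 0 < ρ₀ := (hρ₀ ρ₀ le_rfl).2
  refine eventually_ge_of_drift hρ₀0 (half_pos hκ) (fun ρ hρ => hu ρ (hρ₀0.trans_le hρ))
    (fun ρ hρ hq => ?_)
  obtain ⟨⟨h2, h3⟩, h4⟩ := hρ₀ ρ hρ
  have h5 := hκx (u ρ) ⟨h2, hq⟩
  have h3 : |α| / ρ < κ / 2 := h3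
  have h6 : |α / ρ * sin (2 * u ρ)| ≤ |α| / ρ := by
    rw [abs_mul, abs_div, abs_of_pos h4]
    exact mul_le_of_le_one_right (by positivity) (abs_sin_le_one _)
  have h7 := neg_abs_le (α / ρ * sin (2 * u ρ))
  rw [simplifiedField]
  refine div_le_div_of_nonneg_right ?_ h4.le
  nlinarith

theorem eventually_le (hu : IsSimplifiedSolution k α c u) {b q : ℝ}
    (hb : ∀ᶠ ρ in atTop, u ρ ≤ b) (hneg : ∀ x ∈ Icc q b, c + k * sin (2 * x) < 0) :
    ∀ᶠ ρ in atTop, u ρ ≤ q := by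
  have := hu.neg.eventually_ge (b := -b) (q := -q) (hb.mono fun ρ h => neg_le_neg h)
    (fun x hx => by
      have := hneg (-x) ⟨by linarith [hx.2], by linarith [hx.1]⟩
      rw [mul_neg, sin_neg] at this
      linarith)
  exact this.mono fun ρ h => neg_le_neg_iff.1 h

/-- Where the limiting right-hand side is positive, a solution bounded away from the upper end `q` is
repelled: were it at least `a` at some late point, it would drift up to `q`. -/
theorem eventually_lt (hu : IsSimplifiedSolution k α c u) {a b q : ℝ} (hbq : b < q) (haq : a ≤ q)
    (hb : ∀ᶠ ρ in atTop, u ρ ≤ b) (hpos : ∀ x ∈ Icc a q, 0 < c + k * sin (2 * x)) :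
    ∀ᶠ ρ in atTop, u ρ < a := by
  by_contra hcon
  have h1 : Tendsto (fun ρ : ℝ => c + (k + α / ρ) * sin (2 * a)) atTop
      (𝓝 (c + (k + 0) * sin (2 * a))) :=
    ((tendsto_const_nhds.add (tendsto_const_nhds.div_atTop tendsto_id)).mul_const _).const_add c
  rw [add_zero] at h1
  obtain ⟨ρ₀, hρ₀⟩ := eventually_atTop.1
    ((h1.eventually (Ioi_mem_nhds (hpos a ⟨le_rfl, haq⟩))).and (eventually_gt_atTop 0))
  obtain ⟨s, hs, hsa⟩ := frequently_atTop.1 (not_eventually.1 hcon) ρ₀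
  have h2 : ∀ᶠ ρ in atTop, a ≤ u ρ := by
    filter_upwards [eventually_ge_atTop s] with ρ hρ
    refine ge_of_fence hρ (fun r hr => hu r (hρ₀ r (hs.trans hr.1)).2) (not_lt.1 hsa)
      (fun r hr h => ?_)
    obtain ⟨h3, h4⟩ := hρ₀ r (hs.trans hr.1)
    rw [h, simplifiedField]
    exact div_pos h3 h4
  obtain ⟨ρ, h5, h6⟩ := ((hu.eventually_ge h2 hpos).and hb).exists
  linarith

theorem eventually_gt (hu : IsSimplifiedSolution k α c u) {a b q : ℝ} (hbq : q < b) (haq : q ≤ a)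
    (hb : ∀ᶠ ρ in atTop, b ≤ u ρ) (hneg : ∀ x ∈ Icc q a, c + k * sin (2 * x) < 0) :
    ∀ᶠ ρ in atTop, a < u ρ := by
  have := hu.neg.eventually_lt (a := -a) (b := -b) (q := -q) (by linarith) (by linarith)
    (hb.mono fun ρ h => neg_le_neg h)
    (fun x hx => by
      have := hneg (-x) ⟨by linarith [hx.2], by linarith [hx.1]⟩
      rw [mul_neg, sin_neg] at this
      linarith)
  exact this.mono fun ρ h => neg_lt_neg_iff.1 h

end IsSimplifiedSolution

section signs

variable {k c : ℝ}

theorem add_mul_sin_pos (hc : c ∈ Ioo (-k) 0) {x : ℝ}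
    (hx : x ∈ Ioo (thetaMinus k c) (thetaPlus k c)) : 0 < c + k * sin (2 * x) := by
  have hk : 0 < k := by linarith [hc.1, hc.2]
  obtain ⟨h1, h2⟩ := thetaPlus_mem hc
  obtain ⟨h3, h4⟩ := hx
  rw [thetaMinus_eq hc] at h3
  rw [add_mul_sin_eq hc]
  have hcos : cos (x + thetaPlus k c) < 0 :=
    cos_neg_of_pi_div_two_lt_of_lt (by linarith) (by linarith [pi_pos])
  have hsin : sin (x - thetaPlus k c) < 0 :=
    sin_neg_of_neg_of_neg_pi_lt (by linarith) (by linarith [pi_pos])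
  exact mul_pos_of_neg_of_neg (mul_neg_of_pos_of_neg (by linarith) hcos) hsin

theorem add_mul_sin_neg (hc : c ∈ Ioo (-k) 0) {x : ℝ}
    (hx : x ∈ Ioo (thetaPlus k c) (thetaMinus k c + π)) : c + k * sin (2 * x) < 0 := by
  have hk : 0 < k := by linarith [hc.1, hc.2]
  obtain ⟨h1, h2⟩ := thetaPlus_mem hc
  obtain ⟨h3, h4⟩ := hx
  rw [thetaMinus_eq hc] at h4
  rw [add_mul_sin_eq hc]
  have hcos : cos (x + thetaPlus k c) < 0 :=
    cos_neg_of_pi_div_two_lt_of_lt (by linarith) (by linarith)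
  have hsin : 0 < sin (x - thetaPlus k c) :=
    sin_pos_of_pos_of_lt_pi (by linarith) (by linarith)
  exact mul_neg_of_neg_of_pos (mul_neg_of_pos_of_neg (by linarith) hcos) hsin

theorem add_mul_sin_neg' (hc : c ∈ Ioo (-k) 0) {x : ℝ}
    (hx : x ∈ Ioo (thetaPlus k c - π) (thetaMinus k c)) : c + k * sin (2 * x) < 0 := by
  have := add_mul_sin_neg hc (x := x + π) ⟨by linarith [hx.1], by linarith [hx.2]⟩
  rwa [mul_add, sin_add_two_pi] at this

theorem thetaMinus_mem (hc : c ∈ Ioo (-k) 0) : thetaMinus k c ∈ Ioo 0 (π / 4) := by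
  rw [thetaMinus_eq hc]
  obtain ⟨h1, h2⟩ := thetaPlus_mem hc
  exact ⟨by linarith, by linarith⟩

theorem thetaMinus_lt_thetaMinus {y : ℝ} (hc : c ∈ Ioo (-k) 0) (hy : y ∈ Ioo (-k) 0) (hcy : c < y) :
    thetaMinus k y < thetaMinus k c := by
  have hk : 0 < k := by linarith [hc.1, hc.2]
  by_contra! h
  obtain ⟨h1, h2⟩ := thetaMinus_mem hc
  obtain ⟨h3, h4⟩ := thetaMinus_mem hy
  have e1 := mul_sin_two_mul_thetaPlus hc
  have e2 := mul_sin_two_mul_thetaPlus hy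
  have e3 : ∀ {c}, c ∈ Ioo (-k) 0 → sin (2 * thetaPlus k c) = sin (2 * thetaMinus k c) :=
    fun {c} hc => by
      rw [thetaMinus_eq hc, mul_sub, mul_div_cancel₀ _ two_ne_zero, sin_pi_sub]
  rw [e3 hc] at e1
  rw [e3 hy] at e2
  have h5 : sin (2 * thetaMinus k c) ≤ sin (2 * thetaMinus k y) :=
    sin_le_sin_of_le_of_le_pi_div_two (by linarith) (by linarith) (by linarith)
  have h6 := mul_le_mul_of_nonneg_left h5 hk.le
  linarith

variable {α : ℝ} {u : ℝ → ℝ}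

theorem IsSimplifiedSolution.tendsto_thetaPlus (hu : IsSimplifiedSolution k α c u)
    (hc : c ∈ Ioo (-k) 0) {b₁ b₂ : ℝ} (hb₁ : thetaMinus k c < b₁) (hb₂ : b₂ < thetaMinus k c + π)
    (h₁ : ∀ᶠ ρ in atTop, b₁ ≤ u ρ) (h₂ : ∀ᶠ ρ in atTop, u ρ ≤ b₂) :
    Tendsto u atTop (𝓝 (thetaPlus k c)) := by
  refine tendsto_order.2 ⟨fun a ha => ?_, fun a ha => ?_⟩
  · refine (hu.eventually_ge (q := (a + thetaPlus k c) / 2) h₁ fun x hx =>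
      add_mul_sin_pos hc ⟨by linarith [hx.1], by linarith [hx.2]⟩).mono fun ρ h => by linarith
  · refine (hu.eventually_le (q := (a + thetaPlus k c) / 2) h₂ fun x hx =>
      add_mul_sin_neg hc ⟨by linarith [hx.1], by linarith [hx.2]⟩).mono fun ρ h => by linarith

theorem IsSimplifiedSolution.tendsto_thetaMinus (hu : IsSimplifiedSolution k α c u)
    (hc : c ∈ Ioo (-k) 0) {b₁ b₂ : ℝ} (hb₁ : thetaPlus k c - π < b₁) (hb₂ : b₂ < thetaPlus k c)
    (h₁ : ∀ᶠ ρ in atTop, b₁ ≤ u ρ) (h₂ : ∀ᶠ ρ in atTop, u ρ ≤ b₂) :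
    Tendsto u atTop (𝓝 (thetaMinus k c)) := by
  have hlt : thetaMinus k c < thetaPlus k c :=
    (thetaMinus_mem hc).2.trans (thetaPlus_mem hc).1
  have hlt' : thetaPlus k c - π < thetaMinus k c := by
    linarith [(thetaMinus_mem hc).1, (thetaPlus_mem hc).2, pi_pos]
  refine tendsto_order.2 ⟨fun a ha => ?_, fun a ha => ?_⟩
  · obtain ⟨q, hq₁, hq₂⟩ := exists_between (lt_min hb₁ hlt')
    rw [lt_min_iff] at hq₂
    refine (hu.eventually_gt (a := max a q) hq₂.1 (le_max_right _ _) h₁ fun x hx =>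
      add_mul_sin_neg' hc ⟨hq₁.trans_le hx.1, hx.2.trans_lt (max_lt ha hq₂.2)⟩).mono
      fun ρ h => (le_max_left _ _).trans_lt h
  · obtain ⟨q, hq₁, hq₂⟩ := exists_between (max_lt hb₂ hlt)
    rw [max_lt_iff] at hq₁
    refine (hu.eventually_lt (a := min a q) hq₁.1 (min_le_right _ _) h₂ fun x hx =>
      add_mul_sin_pos hc ⟨(lt_min ha hq₁.2).trans_le hx.1, hx.2.trans_lt hq₂⟩).mono
      fun ρ h => h.trans_le (min_le_left _ _)

end signs

/-! ### The limit of the distinguished solution of the simplified equation -/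

/-- `ϑ₀(·, c)`, the distinguished solution of the simplified equation for `α = -1`. -/
noncomputable def simplifiedAngle (k c : ℝ) : ℝ → ℝ :=
  solutionFromZero (simplifiedField k (-1) c) (angleAtZero (-1))

theorem angleAtZero_neg_one : angleAtZero (-1) = π := if_neg (by norm_num)

theorem isSolutionFromZero_simplifiedAngle (k c : ℝ) :
    IsSolutionFromZero (simplifiedField k (-1) c) (angleAtZero (-1)) (simplifiedAngle k c) :=
  (hasUniqueSolutionFromZero_simplifiedField k c (Or.inr rfl)).isSolutionFromZero

theorem isSimplifiedSolution_simplifiedAngle (k c : ℝ) :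
    IsSimplifiedSolution k (-1) c (simplifiedAngle k c) :=
  (isSolutionFromZero_simplifiedAngle k c).1

theorem continuous_simplifiedAngle {k : ℝ} (hk : 0 < k) {ρ : ℝ} (hρ : 0 < ρ) :
    Continuous fun c => simplifiedAngle k c ρ := by
  refine continuous_iff_continuousAt.2 fun c => Metric.tendsto_nhds.2 fun η hη => ?_
  obtain ⟨ε, hε, h⟩ := exists_forall_abs_sub_le_of_perturbation hk (Or.inr rfl)
    (isSolutionFromZero_simplifiedAngle k c) hρ (half_pos hη)
  filter_upwards [Metric.closedBall_mem_nhds c hε] with x hx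
  have := h (simplifiedAngle k x) (fun _ => x - c)
    (fun s hs => (isSimplifiedSolution_simplifiedAngle k x s hs.1).congr_deriv (by
      rw [simplifiedField]; ring))
    (fun s _ => by simpa [Real.dist_eq] using hx) (isSolutionFromZero_simplifiedAngle k x).2
  rw [Real.dist_eq]
  linarith

/-- Comparison: `ϑ₀` is nondecreasing in `c`. -/
theorem simplifiedAngle_le_of_lt {k x y : ℝ} (hk : 0 < k) (hxy : x < y) {ρ : ℝ} (hρ : 0 < ρ) :
    simplifiedAngle k x ρ ≤ simplifiedAngle k y ρ := by
  have hx := isSolutionFromZero_simplifiedAngle k x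
  have hy := isSolutionFromZero_simplifiedAngle k y
  have hderiv : ∀ r, 0 < r → HasDerivAt (fun r => simplifiedAngle k x r - simplifiedAngle k y r)
      ((x - y + 2 * ((k - 1 / r) * cos (simplifiedAngle k y r + simplifiedAngle k x r)) *
        sin (simplifiedAngle k x r - simplifiedAngle k y r)) / r) r := fun r hr =>
    ((hx.1 r hr).sub (hy.1 r hr)).congr_deriv (by
      rw [simplifiedField, simplifiedField, ← sub_div]
      congr 1
      linear_combination
        (k + -1 / r) * sin_two_mul_sub (simplifiedAngle k y r) (simplifiedAngle k x r))
  obtain ⟨δ, hδ, hδs⟩ := mem_nhdsGT_iff_exists_Ioc_subset.1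
    ((hx.eventually_abs_sub_le (ε := 1 / 4) (by norm_num)).and
      (hy.eventually_abs_sub_le (ε := 1 / 4) (by norm_num)))
  have hδ : 0 < δ := hδ
  set T := min (min δ (1 / k)) ρ with hTdef
  have hT : 0 < T := by positivity
  -- near `0` the equation is contracting, so a difference `ε > 0` cannot be reached from below
  have h1 : ∀ ε ∈ Ioc (0 : ℝ) 1, simplifiedAngle k x T - simplifiedAngle k y T ≤ ε := by
    intro ε hε
    obtain ⟨a, ha, ha0, haT⟩ :=
      ((hx.eventually_abs_sub_solution_le hy hε.1).and (Ioo_mem_nhdsGT hT)).exists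
    refine le_of_fence (u := fun r => simplifiedAngle k x r - simplifiedAngle k y r) haT.le
      (fun r hr => hderiv r (ha0.trans_le hr.1))
      ((le_abs_self _).trans ha) (fun r hr h => ?_)
    have hr0 : 0 < r := ha0.trans_le hr.1
    have hrT : r ≤ min δ (1 / k) := hr.2.trans (min_le_left _ _)
    obtain ⟨h2, h3⟩ := hδs ⟨hr0, hrT.trans (min_le_left _ _)⟩
    have h4 : 0 ≤ cos (simplifiedAngle k y r + simplifiedAngle k x r) := by
      have := mul_cos_le_of_abs_sub_le (α := -1)
        (s := simplifiedAngle k y r + simplifiedAngle k x r) (Or.inr rfl) (by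
          rw [abs_le] at h2 h3 ⊢; constructor <;> linarith)
      linarith
    have h5 : k - 1 / r ≤ 0 := by
      have : r ≤ 1 / k := hrT.trans (min_le_right _ _)
      rw [le_div_iff₀ hk] at this
      rw [sub_nonpos, le_div_iff₀ hr0]
      linarith
    have h6 : 0 ≤ sin ε := sin_nonneg_of_nonneg_of_le_pi hε.1.le (by linarith [hε.2, pi_gt_three])
    rw [show simplifiedAngle k x r - simplifiedAngle k y r = ε from h]
    refine div_neg_of_neg_of_pos ?_ hr0
    have h7 := mul_nonneg (mul_nonneg (neg_nonneg.2 h5) h4) h6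
    linarith
  have h2 : simplifiedAngle k x T - simplifiedAngle k y T ≤ 0 := by
    by_contra! h
    have := h1 (min 1 ((simplifiedAngle k x T - simplifiedAngle k y T) / 2))
      ⟨by positivity, min_le_left _ _⟩
    linarith [min_le_right 1 ((simplifiedAngle k x T - simplifiedAngle k y T) / 2)]
  have h3 := le_of_fence (u := fun r => simplifiedAngle k x r - simplifiedAngle k y r)
    (min_le_right _ _ : T ≤ ρ) (fun r hr => hderiv r (hT.trans_le hr.1)) h2
    (fun r hr h => by
      rw [show simplifiedAngle k x r - simplifiedAngle k y r = 0 from h, sin_zero, mul_zero,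
        add_zero]
      exact div_neg_of_neg_of_pos (by linarith) (hT.trans_le hr.1))
  linarith

namespace IsSimplifiedSolution

variable {k α c : ℝ} {u : ℝ → ℝ}

/-- The line `ϑ = 0` is crossed downwards only. -/
theorem le_zero_of_le (hu : IsSimplifiedSolution k α c u) (hc : c < 0) {s ρ : ℝ} (hs : 0 < s)
    (hsρ : s ≤ ρ) (h : u s ≤ 0) : u ρ ≤ 0 :=
  le_of_fence hsρ (fun r hr => hu r (hs.trans_le hr.1)) h (fun r hr h => by
    rw [h, simplifiedField, mul_zero, sin_zero, mul_zero, add_zero]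
    exact div_neg_of_neg_of_pos hc (hs.trans_le hr.1))

/-- The line `ϑ = π / 4` is crossed upwards only, once `c + k + α / ϱ > 0`. -/
theorem pi_div_four_le_of_le (hu : IsSimplifiedSolution k α c u) {s ρ : ℝ} (hs : 0 < s)
    (hsρ : s ≤ ρ) (hpos : ∀ r ∈ Icc s ρ, 0 < c + (k + α / r)) (h : π / 4 ≤ u s) : π / 4 ≤ u ρ :=
  ge_of_fence hsρ (fun r hr => hu r (hs.trans_le hr.1)) h (fun r hr h => by
    rw [h, simplifiedField, show 2 * (π / 4) = π / 2 by ring, sin_pi_div_two, mul_one]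
    exact div_pos (hpos r hr) (hs.trans_le hr.1))

end IsSimplifiedSolution

section dichotomy

variable {k c : ℝ}

/-- The parameters for which `ϑ₀` falls below `-m π`. -/
def fallsBelow (k : ℝ) (m : ℕ) : Set ℝ := {c | ∃ ρ > 0, simplifiedAngle k c ρ + m * π < 0}

/-- The parameters for which `ϑ₀` is above `π / 4 - m π` at a point `ϱ > 1 / (k + c)`, and hence
at all later points. -/
def staysAbove (k : ℝ) (m : ℕ) : Set ℝ :=
  {c | ∃ ρ > 0, 1 < ρ * (k + c) ∧ π / 4 < simplifiedAngle k c ρ + m * π}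

theorem isOpen_fallsBelow (hk : 0 < k) (m : ℕ) : IsOpen (fallsBelow k m) := by
  have : fallsBelow k m = ⋃ ρ > 0, {c | simplifiedAngle k c ρ + m * π < 0} := by
    ext c; simp [fallsBelow]
  rw [this]
  refine isOpen_iUnion fun ρ => isOpen_iUnion fun hρ => ?_
  exact isOpen_lt ((continuous_simplifiedAngle hk hρ).add continuous_const) continuous_const

theorem isOpen_staysAbove (hk : 0 < k) (m : ℕ) : IsOpen (staysAbove k m) := by
  have : staysAbove k m =
      ⋃ ρ > 0, ({c | 1 < ρ * (k + c)} ∩ {c | π / 4 < simplifiedAngle k c ρ + m * π}) := by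
    ext c; simp [staysAbove, and_left_comm]
  rw [this]
  refine isOpen_iUnion fun ρ => isOpen_iUnion fun hρ => IsOpen.inter ?_ ?_
  · exact isOpen_lt continuous_const (by fun_prop)
  · exact isOpen_lt continuous_const ((continuous_simplifiedAngle hk hρ).add continuous_const)

theorem eventually_le_zero_of_mem_fallsBelow {m : ℕ} (hc : c ∈ Ioo (-k) 0)
    (h : c ∈ fallsBelow k m) : ∀ᶠ ρ in atTop, simplifiedAngle k c ρ + m * π ≤ 0 := by
  obtain ⟨s, hs, h⟩ := h
  filter_upwards [eventually_ge_atTop s] with ρ hρ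
  exact ((isSimplifiedSolution_simplifiedAngle k c).add_nat_mul_pi m).le_zero_of_le hc.2 hs hρ h.le

theorem eventually_pi_div_four_le_of_mem_staysAbove {m : ℕ}
    (h : c ∈ staysAbove k m) : ∀ᶠ ρ in atTop, π / 4 ≤ simplifiedAngle k c ρ + m * π := by
  obtain ⟨s, hs, hs1, h⟩ := h
  filter_upwards [eventually_ge_atTop s] with ρ hρ
  refine ((isSimplifiedSolution_simplifiedAngle k c).add_nat_mul_pi m).pi_div_four_le_of_le hs hρ
    (fun r hr => ?_) h.le
  have hr0 : 0 < r := hs.trans_le hr.1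
  have hkc : 0 < k + c := pos_of_mul_pos_right (by linarith) hs.le
  have h1 : 1 < r * (k + c) := hs1.trans_le (mul_le_mul_of_nonneg_right hr.1 hkc.le)
  have h2 : 1 / r < k + c := by rwa [div_lt_iff₀' hr0]
  rw [neg_div]
  linarith

/-- A solution in neither class ends up in `[-m π, π / 4 - m π]`, where `ϑ₋(c) - m π` is the only
possible limit. -/
theorem isExceptionalValue_of_notMem {m : ℕ} (hc : c ∈ Ioo (-k) 0) (h₁ : c ∉ fallsBelow k m)
    (h₂ : c ∉ staysAbove k m) : IsExceptionalValue k m c := by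
  refine ⟨hc, simplifiedAngle k c, isSolutionFromZero_simplifiedAngle k c, ?_⟩
  have hkc : 0 < k + c := by linarith [hc.1]
  have h3 : ∀ᶠ ρ in atTop, 0 ≤ simplifiedAngle k c ρ + m * π := by
    filter_upwards [eventually_gt_atTop 0] with ρ hρ
    by_contra! h
    exact h₁ ⟨ρ, hρ, h⟩
  have h4 : ∀ᶠ ρ in atTop, simplifiedAngle k c ρ + m * π ≤ π / 4 := by
    filter_upwards [eventually_gt_atTop 0, eventually_gt_atTop (1 / (k + c))] with ρ hρ hρ'
    by_contra! h
    exact h₂ ⟨ρ, hρ, by rwa [div_lt_iff₀ hkc] at hρ', h⟩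
  have := ((isSimplifiedSolution_simplifiedAngle k c).add_nat_mul_pi m).tendsto_thetaMinus hc
    (by linarith [(thetaPlus_mem hc).2, pi_pos]) (thetaPlus_mem hc).1 h3 h4
  simpa using this.sub_const (m * π)

theorem IsExceptionalValue.tendsto_simplifiedAngle {m : ℕ} (h : IsExceptionalValue k m c) :
    Tendsto (simplifiedAngle k c) atTop (𝓝 (thetaMinus k c - m * π)) := by
  obtain ⟨-, θ, hθ, hlim⟩ := h
  refine hlim.congr' ?_
  filter_upwards [eventually_gt_atTop 0] with ρ hρ
  exact (hasUniqueSolutionFromZero_simplifiedField k c (Or.inr rfl)).eq hθ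
    (isSolutionFromZero_simplifiedAngle k c) hρ

/-- For `c` close to `0`, the distinguished solution is still close to `π`, the solution for
`c = 0`, at the point `4 / k`. -/
theorem exists_gt_mem_staysAbove_zero (hc : c ∈ Ioo (-k) 0) :
    ∃ y ∈ Ioo c 0, y ∈ staysAbove k 0 := by
  have hk : 0 < k := by linarith [hc.1, hc.2]
  have hT : 0 < 4 / k := by positivity
  have h0 : simplifiedAngle k 0 (4 / k) = π := by
    refine (hasUniqueSolutionFromZero_simplifiedField k 0 (Or.inr rfl)).eq
      (isSolutionFromZero_simplifiedAngle k 0) (v := fun _ => π) ⟨fun r _ => ?_, ?_⟩ hT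
    · simpa [simplifiedField] using hasDerivAt_const r π
    · rw [angleAtZero_neg_one]; exact tendsto_const_nhds
  have h1 : ∀ᶠ y in 𝓝 (0 : ℝ), π / 4 < simplifiedAngle k y (4 / k) :=
    (continuous_simplifiedAngle hk hT).continuousAt.eventually
      (Ioi_mem_nhds (show π / 4 < simplifiedAngle k 0 (4 / k) by rw [h0]; linarith [pi_pos]))
  have h2 : ∀ᶠ y in 𝓝 (0 : ℝ), -(k / 2) < y := Ioi_mem_nhds (by linarith)
  obtain ⟨y, ⟨h3, h4⟩, h5⟩ :=
    (((h1.and h2).filter_mono (nhdsWithin_le_nhds (s := Iio 0))).and (Ioo_mem_nhdsLT hc.2)).exists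
  refine ⟨y, h5, 4 / k, hT, ?_, by simpa using h3⟩
  rw [div_mul_eq_mul_div, lt_div_iff₀ hk]
  linarith

/-- If no exceptional value `c_m` lies in `[c, 0)`, and some larger parameter stays above
`π / 4 - m π`, so does `c`: otherwise the two open conditions would disconnect `[c, y]`. -/
theorem mem_staysAbove_of_lt {m : ℕ} {y : ℝ} (hc : c ∈ Ioo (-k) 0) (hy : y ∈ Ioo c 0)
    (hex : ∀ x, IsExceptionalValue k m x → x < c) (hys : y ∈ staysAbove k m) :
    c ∈ staysAbove k m := by
  have hk : 0 < k := by linarith [hc.1, hc.2]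
  have hsub : ∀ x ∈ Icc c y, x ∈ Ioo (-k) 0 :=
    fun x hx => ⟨hc.1.trans_le hx.1, hx.2.trans_lt hy.2⟩
  have hcover : Icc c y ⊆ fallsBelow k m ∪ staysAbove k m := fun x hx => by
    by_contra h
    rw [mem_union, not_or] at h
    exact absurd (hex x (isExceptionalValue_of_notMem (hsub x hx) h.1 h.2)) (not_lt.2 hx.1)
  have hcI : c ∈ Icc c y := ⟨le_rfl, hy.1.le⟩
  by_contra hcs
  obtain ⟨x, hx, hxA, hxB⟩ := isPreconnected_Icc _ _ (isOpen_fallsBelow hk m)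
    (isOpen_staysAbove hk m) hcover ⟨c, hcI, (hcover hcI).resolve_right hcs⟩
    ⟨y, ⟨hy.1.le, le_rfl⟩, hys⟩
  obtain ⟨ρ, h1, h2⟩ := ((eventually_le_zero_of_mem_fallsBelow (hsub x hx) hxA).and
    (eventually_pi_div_four_le_of_mem_staysAbove hxB)).exists
  linarith [pi_pos]

/-- The line `ϑ = π + ϑ₋(c) / 2`, just above the initial value `π`, is crossed downwards only. -/
theorem eventually_simplifiedAngle_le (hc : c ∈ Ioo (-k) 0) :
    ∀ᶠ ρ in atTop, simplifiedAngle k c ρ ≤ π + thetaMinus k c / 2 := by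
  obtain ⟨h1, h2⟩ := thetaMinus_mem hc
  have h := isSolutionFromZero_simplifiedAngle k c
  have hneg := add_mul_sin_neg' hc (x := thetaMinus k c / 2)
    ⟨by linarith [(thetaPlus_mem hc).2, pi_pos], by linarith⟩
  have hsin : 0 ≤ sin (2 * (thetaMinus k c / 2)) :=
    sin_nonneg_of_nonneg_of_le_pi (by linarith) (by linarith [pi_pos])
  filter_upwards [eventually_gt_atTop 0] with ρ hρ
  obtain ⟨a, ha, ha0, haρ⟩ := ((h.eventually_abs_sub_le (half_pos h1)).and
    (Ioo_mem_nhdsGT hρ)).exists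
  rw [angleAtZero_neg_one] at ha
  refine le_of_fence haρ.le (fun r hr => h.1 r (ha0.trans_le hr.1))
    (by linarith [le_abs_self (simplifiedAngle k c a - π)]) (fun r hr h => ?_)
  have hr : 0 < r := ha0.trans_le hr.1
  rw [h, simplifiedField, mul_add, add_comm (2 * π), sin_add_two_pi]
  refine div_neg_of_neg_of_pos ?_ hr
  have : (k + -1 / r) * sin (2 * (thetaMinus k c / 2)) ≤ k * sin (2 * (thetaMinus k c / 2)) := by
    refine mul_le_mul_of_nonneg_right ?_ hsin
    rw [neg_div]
    linarith [one_div_pos.2 hr]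
  linarith

end dichotomy

/-- The exceptional values being avoided, the distinguished solution of the simplified equation
tends to the stable limit `ϑ₊(c) - m π`. -/
theorem tendsto_of_mem_admissibleSet {k α c : ℝ} {m : ℕ} (hc : c ∈ admissibleSet k α m)
    {v : ℝ → ℝ} (hv : IsSolutionFromZero (simplifiedField k α c) (angleAtZero α) v) :
    Tendsto v atTop (𝓝 (thetaPlus k c - m * π)) := by
  obtain ⟨hc, ⟨rfl, rfl⟩ | ⟨rfl, hex, hbelow⟩⟩ := hc
  · have hk : 0 < k := by linarith [hc.1, hc.2]
    have hv' : IsSimplifiedSolution k 1 c v := hv.1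
    have h1 : angleAtZero 1 = π / 2 := if_pos rfl
    have h2 := thetaMinus_mem hc
    have hev : ∀ ρ > 0, π / 4 ≤ v ρ ∧ v ρ ≤ π := fun ρ hρ => by
      obtain ⟨a, ha, ha0, haρ⟩ := ((hv.eventually_abs_sub_le (ε := π / 4) (by positivity)).and
        (Ioo_mem_nhdsGT hρ)).exists
      rw [h1, abs_le] at ha
      constructor
      · refine hv'.pi_div_four_le_of_le ha0 haρ.le (fun r hr => ?_) (by linarith)
        have : 0 < 1 / r := one_div_pos.2 (ha0.trans_le hr.1)
        linarith [hc.1]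
      · refine le_of_fence haρ.le (fun r hr => hv.1 r (ha0.trans_le hr.1)) (by linarith [pi_pos])
          (fun r hr h => ?_)
        rw [h, simplifiedField, sin_two_pi, mul_zero, add_zero]
        exact div_neg_of_neg_of_pos hc.2 (ha0.trans_le hr.1)
    have := hv'.tendsto_thetaPlus hc (b₁ := π / 4) (b₂ := π) h2.2 (by linarith [h2.1])
      ((eventually_gt_atTop 0).mono fun ρ hρ => (hev ρ hρ).1)
      ((eventually_gt_atTop 0).mono fun ρ hρ => (hev ρ hρ).2)
    simpa using this
  · have hk : 0 < k := by linarith [hc.1, hc.2]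
    have h2 := thetaMinus_mem hc
    have hvθ : v =ᶠ[atTop] simplifiedAngle k c :=
      (eventually_gt_atTop 0).mono fun ρ hρ =>
        (hasUniqueSolutionFromZero_simplifiedField k c (Or.inr rfl)).eq hv
          (isSolutionFromZero_simplifiedAngle k c) hρ
    refine Tendsto.congr' hvθ.symm ?_
    obtain ⟨b, hb, habove, hupper⟩ : ∃ b < thetaMinus k c + π, c ∈ staysAbove k m ∧
        ∀ᶠ ρ in atTop, simplifiedAngle k c ρ + m * π ≤ b := by
      cases m with
      | zero =>
        obtain ⟨y, hy, hys⟩ := exists_gt_mem_staysAbove_zero hc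
        exact ⟨π + thetaMinus k c / 2, by linarith [h2.1], mem_staysAbove_of_lt hc hy hex hys,
          by simpa using eventually_simplifiedAngle_le hc⟩
      | succ j =>
        obtain ⟨y, hyex, hcy⟩ := hbelow
        have hym := thetaMinus_mem hyex.1
        have hlim := hyex.tendsto_simplifiedAngle
        have hky : 0 < k + y := by linarith [hyex.1.1]
        obtain ⟨b, hb₁, hb₂⟩ := exists_between (thetaMinus_lt_thetaMinus hc hyex.1 hcy)
        refine ⟨b + π, by linarith, mem_staysAbove_of_lt hc ⟨hcy, hyex.1.2⟩ hex ?_, ?_⟩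
        · obtain ⟨ρ, ⟨h3, h4⟩, h5⟩ := (((hlim.eventually (Ioi_mem_nhds
            (show -(j * π) < thetaMinus k y - j * π by linarith [hym.1]))).and
            (eventually_gt_atTop 0)).and (eventually_gt_atTop (1 / (k + y)))).exists
          refine ⟨ρ, h4, by rwa [div_lt_iff₀ hky] at h5, ?_⟩
          have h3 : -(j * π) < simplifiedAngle k y ρ := h3
          push_cast
          linarith [pi_pos]
        · filter_upwards [hlim.eventually (Iio_mem_nhds
            (show thetaMinus k y - j * π < b - j * π by linarith)), eventually_gt_atTop 0]
            with ρ h3 h4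
          have h3 : simplifiedAngle k y ρ < b - j * π := h3
          have h5 := simplifiedAngle_le_of_lt hk hcy h4
          push_cast
          linarith
    have := ((isSimplifiedSolution_simplifiedAngle k c).add_nat_mul_pi m).tendsto_thetaPlus hc
      h2.2 hb (eventually_pi_div_four_le_of_mem_staysAbove habove) hupper
    simpa using this.sub_const (m * π)

/-! ### Matching the two Prüfer angles -/

theorem abs_mul_cos_sub_le {μ lam : ℝ} (hμ : |μ| = 1) (hl : lam ∈ Icc (-1 : ℝ) 1) (x : ℝ) :
    |μ * cos x - lam| ≤ 2 := by
  refine (abs_sub _ _).trans ?_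
  rw [abs_mul, hμ, one_mul]
  linarith [abs_cos_le_one x, abs_le.2 hl]

/-- The solutions `X₀(·, c, λ)` stay close to `ϑ₊(c)` on a small interval, uniformly in `λ`. -/
theorem IsSolutionFromZero.abs_sub_thetaPlus_le {k μ c lam κ η₀ η r₀ : ℝ} {X : ℝ → ℝ}
    (hX : IsSolutionFromZero (coulombField k μ c lam) (thetaPlus k c) X)
    (hc : c ∈ Ioo (-k) 0) (hμ : |μ| = 1) (hl : lam ∈ Icc (-1 : ℝ) 1) (hη₀ : η₀ ≤ 1)
    (hcos : ∀ s, |s - 2 * thetaPlus k c| ≤ 3 * η₀ → cos s ≤ -κ) (hκ : 0 < κ) (hη : 0 < η)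
    (hηη₀ : η ≤ η₀) (hr₀ : 2 * r₀ < k * κ * η) : ∀ r ∈ Ioc 0 r₀, |X r - thetaPlus k c| ≤ η := by
  have hk : 0 < k := by linarith [hc.1, hc.2]
  refine abs_le_of_fence_from_zero (B := fun _ => η) (B' := fun _ => 0)
    (fun r hr => (hX.1 r hr.1).sub_const (thetaPlus k c)) (fun r => hasDerivAt_const r η)
    (fun _ => hη.le) (hX.eventually_abs_sub_le hη) (fun r hr hw => ?_)
  set w := X r - thetaPlus k c with hwdef
  have hr0 : 0 < r := hr.1
  have e : w * coulombField k μ c lam r (X r) =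
      (2 * k * cos (X r + thetaPlus k c) * (w * sin w) + r * (w * (μ * cos (2 * X r) - lam))) / r := by
    have h := add_mul_sin_eq hc (X r)
    rw [← hwdef] at h
    rw [eq_div_iff hr0.ne', coulombField]
    generalize sin (2 * X r) = s at h ⊢
    generalize cos (2 * X r) = t
    field_simp
    linear_combination w * h
  rw [mul_zero, e]
  refine div_neg_of_neg_of_pos ?_ hr0
  have h1 : cos (X r + thetaPlus k c) ≤ -κ := hcos _ (by
    rw [show X r + thetaPlus k c - 2 * thetaPlus k c = w by rw [hwdef]; ring, hw]; linarith)
  have h2 := sq_half_le_mul_sin (w := w) (by linarith)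
  rw [← sq_abs, hw] at h2
  have h3 : w * (μ * cos (2 * X r) - lam) ≤ η * 2 := by
    refine (le_abs_self _).trans ?_
    rw [abs_mul, hw]
    exact mul_le_mul_of_nonneg_left (abs_mul_cos_sub_le hμ hl _) hη.le
  have h4 : k * cos (X r + thetaPlus k c) * (w * sin w) ≤ k * -κ * (w * sin w) :=
    mul_le_mul_of_nonneg_right (mul_le_mul_of_nonneg_left h1 hk.le)
      (mul_sin_nonneg (by linarith))
  have h5 : k * κ * (η ^ 2 / 2) ≤ k * κ * (w * sin w) :=
    mul_le_mul_of_nonneg_left h2 (by positivity)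
  have h6 : r * (w * (μ * cos (2 * X r) - lam)) ≤ r * (η * 2) := mul_le_mul_of_nonneg_left h3 hr0.le
  have h7 : 2 * r * η < k * κ * η * η := mul_lt_mul_of_pos_right (by linarith [hr.2]) hη
  linarith

/-- Away from the scale `r ~ |a|` the anomalous term is a small perturbation, and the two equations
contract towards each other near `ϑ₊(c)`. -/
theorem abs_sub_le_of_pruefer_of_coulomb {k α μ c a lam κ η₀ ε r₀ R : ℝ} {Y X : ℝ → ℝ}
    (hk : 0 < k) (hα : |α| = 1) (hμ : |μ| = 1) (hκ : 0 < κ) (hη₀ : η₀ ≤ 1)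
    (hcos : ∀ s, |s - 2 * thetaPlus k c| ≤ 3 * η₀ → cos s ≤ -κ) (hr₀ : 0 < r₀) (hR : r₀ ≤ R)
    (hRκ : 2 * R ≤ k * κ) (hε : 0 < ε) (hεη₀ : ε ≤ η₀) (ha : |a| / r₀ < k * κ * ε / 2)
    (hY : ∀ r ∈ Icc r₀ R, HasDerivAt Y (prueferField k α μ c a lam r (Y r)) r)
    (hX : ∀ r ∈ Icc r₀ R, HasDerivAt X (coulombField k μ c lam r (X r)) r)
    (hXη : ∀ r ∈ Icc r₀ R, |X r - thetaPlus k c| ≤ η₀) (h₀ : |Y r₀ - X r₀| ≤ ε) :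
    |Y R - X R| ≤ ε := by
  refine abs_le_of_fence (w := fun r => Y r - X r) (B := fun _ => ε) (B' := fun _ => 0) hR
    (fun r hr => (hY r hr).sub (hX r hr)) (fun r => hasDerivAt_const r ε) (fun _ => hε.le) h₀
    (fun r hr hw => ?_)
  set w := Y r - X r with hwdef
  have hr0 : 0 < r := hr₀.trans_le hr.1
  have e : w * (prueferField k α μ c a lam r (Y r) - coulombField k μ c lam r (X r)) =
      ((2 * k * cos (X r + Y r) - 2 * r * (μ * sin (X r + Y r))) * (w * sin w) +
        |a| / r * (w * (α * sin (2 * Y r)))) / r := by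
    have h1 := sin_two_mul_sub (X r) (Y r)
    have h2 := cos_two_mul_sub (X r) (Y r)
    rw [← hwdef] at h1 h2
    rw [eq_div_iff hr0.ne', prueferField, coulombField]
    generalize sin (2 * X r) = s at h1 ⊢
    generalize sin (2 * Y r) = s' at h1 ⊢
    generalize cos (2 * X r) = t at h2 ⊢
    generalize cos (2 * Y r) = t' at h2 ⊢
    field_simp
    linear_combination w * r * k * h1 + w * r ^ 2 * μ * h2
  rw [mul_zero, e]
  refine div_neg_of_neg_of_pos ?_ hr0
  have hws := mul_sin_nonneg (w := w) (by linarith)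
  have h1 : cos (X r + Y r) ≤ -κ := hcos _ (by
    rw [show X r + Y r - 2 * thetaPlus k c = 2 * (X r - thetaPlus k c) + w by rw [hwdef]; ring]
    refine (abs_add_le _ _).trans ?_
    rw [abs_mul, abs_two]
    linarith [hXη r hr])
  have h2 := sq_half_le_mul_sin (w := w) (by linarith)
  rw [← sq_abs, hw] at h2
  have h3 : -(μ * sin (X r + Y r)) ≤ 1 := (neg_le_abs _).trans (by
    rw [abs_mul, hμ, one_mul]; exact abs_sin_le_one _)
  have h4 : 2 * k * cos (X r + Y r) - 2 * r * (μ * sin (X r + Y r)) ≤ -(k * κ) := by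
    have h5 := mul_le_mul_of_nonneg_left h1 hk.le
    have h6 := mul_le_mul_of_nonneg_left h3 hr0.le
    linarith [hr.2]
  have h5 : w * (α * sin (2 * Y r)) ≤ ε := (le_abs_self _).trans (by
    rw [abs_mul, hw, abs_mul, hα, one_mul]
    exact mul_le_of_le_one_right hε.le (abs_sin_le_one _))
  have h6 : |a| / r ≤ |a| / r₀ := div_le_div_of_nonneg_left (abs_nonneg a) hr₀ hr.1
  have h7 : |a| / r * (w * (α * sin (2 * Y r))) ≤ |a| / r₀ * ε :=
    (mul_le_mul_of_nonneg_left h5 (by positivity)).trans (mul_le_mul_of_nonneg_right h6 hε.le)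
  have h8 := mul_le_mul_of_nonneg_right h4 hws
  have h9 : k * κ * (ε ^ 2 / 2) ≤ k * κ * (w * sin w) :=
    mul_le_mul_of_nonneg_left h2 (by positivity)
  have h10 := mul_lt_mul_of_pos_right ha hε
  linarith

/-- In the scaled variable `ϱ = r / |a|` the Prüfer equation is a perturbation of the simplified
equation. -/
theorem hasDerivAt_comp_abs_mul {k α μ c a lam : ℝ} (ha : a ≠ 0) {Θ : ℝ → ℝ}
    (hΘ : ∀ r, 0 < r → HasDerivAt Θ (prueferField k α μ c a lam r (Θ r)) r) {ρ : ℝ} (hρ : 0 < ρ) :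
    HasDerivAt (fun ρ => Θ (|a| * ρ)) ((c + (k + α / ρ) * sin (2 * Θ (|a| * ρ)) +
      |a| * ρ * (μ * cos (2 * Θ (|a| * ρ)) - lam)) / ρ) ρ := by
  have ha' : 0 < |a| := abs_pos.2 ha
  have h := (hΘ (|a| * ρ) (by positivity)).comp ρ ((hasDerivAt_id ρ).const_mul |a|)
  refine h.congr_deriv ?_
  rw [prueferField]
  field_simp
  ring

theorem prueferField_add_nat_mul_pi (k α μ c a lam r θ : ℝ) (m : ℕ) :
    prueferField k α μ c a lam r (θ + m * π) = prueferField k α μ c a lam r θ := by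
  have : 2 * (θ + m * π) = 2 * θ + m * (2 * π) := by ring
  simp only [prueferField, this, sin_add_nat_mul_two_pi, cos_add_nat_mul_two_pi]

theorem proposition3p3 (k α μ c : ℝ) (m : ℕ) (hk : 0 < k)
    (hα : α = 1 ∨ α = -1) (hμ : μ = 1 ∨ μ = -1) (hc : c ∈ admissibleSet k α m) :
    (∀ lam ∈ Icc (-1 : ℝ) 1,
      (∀ a : ℝ, a < 0 →
        HasUniqueSolutionFromZero (prueferField k α μ c a lam) (angleAtZero α)) ∧
      HasUniqueSolutionFromZero (coulombField k μ c lam) (thetaPlus k c)) ∧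
    ∃ R : ℝ, 0 < R ∧
      TendstoUniformlyOn (fun a lam : ℝ => Theta0 k α μ c a lam R + m * π)
        (fun lam : ℝ => X0 k μ c lam R) (𝓝[<] (0 : ℝ)) (Icc (-1) 1) := by
  have hcI : c ∈ Ioo (-k) 0 := hc.1
  refine ⟨fun lam _ => ⟨fun a ha => hasUniqueSolutionFromZero_prueferField k μ c lam hα ha.ne,
    hasUniqueSolutionFromZero_coulombField μ lam hcI⟩, ?_⟩
  have hα1 : |α| = 1 := by rcases hα with rfl | rfl <;> simp
  have hμ1 : |μ| = 1 := by rcases hμ with rfl | rfl <;> simp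
  obtain ⟨κ, hκ, η₀, hη₀, hη₀1, hcos⟩ := exists_cos_le_near_thetaPlus hcI
  have hR : 0 < k * κ * η₀ / 4 := by positivity
  refine ⟨k * κ * η₀ / 4, hR, Metric.tendstoUniformlyOn_iff.2 fun ε' hε' => ?_⟩
  set R := k * κ * η₀ / 4 with hRdef
  obtain ⟨ε, hε, hεε', hεη₀⟩ : ∃ ε > 0, ε < ε' ∧ ε ≤ η₀ :=
    ⟨min (ε' / 2) η₀, by positivity, (min_le_left _ _).trans_lt (by linarith), min_le_right _ _⟩
  have hv := (hasUniqueSolutionFromZero_simplifiedField k c hα).isSolutionFromZero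
  set v := solutionFromZero (simplifiedField k α c) (angleAtZero α)
  -- the matching point in the scaled variable, where the distinguished solution of the simplified
  -- equation has almost reached its limit
  obtain ⟨T, ⟨hvT, hTκ⟩, hT⟩ : ∃ T, (|v T - (thetaPlus k c - m * π)| ≤ ε / 4 ∧
      1 / T < k * κ * ε / 2) ∧ 0 < T := by
    have h1 := (tendsto_of_mem_admissibleSet hc hv).eventually
      (Metric.closedBall_mem_nhds _ (show 0 < ε / 4 by positivity))
    have h2 : Tendsto (fun T : ℝ => 1 / T) atTop (𝓝 0) := tendsto_const_nhds.div_atTop tendsto_id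
    have h3 := h2.eventually (Iio_mem_nhds (show 0 < k * κ * ε / 2 by positivity))
    exact ((h1.and h3).and (eventually_gt_atTop 0)).exists
  obtain ⟨δ, hδ, hpert⟩ := exists_forall_abs_sub_le_of_perturbation hk hα hv hT
    (show 0 < ε / 4 by positivity)
  have hsmall : ∀ x : ℝ, 0 < x → ∀ᶠ a in 𝓝[<] (0 : ℝ), |a| * T < x := fun x hx => by
    have : ContinuousAt (fun a : ℝ => |a| * T) 0 := by fun_prop
    exact (this.eventually (Iio_mem_nhds (by simpa using hx))).filter_mono nhdsWithin_le_nhds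
  filter_upwards [hsmall _ (half_pos hδ), hsmall _ (show 0 < k * κ * (ε / 4) / 2 by positivity),
    hsmall _ hR, self_mem_nhdsWithin] with a ha₁ ha₂ ha₃ ha lam hl
  have ha0 : a ≠ 0 := ne_of_lt ha
  have hapos : 0 < |a| := abs_pos.2 ha0
  have hr₀ : 0 < |a| * T := by positivity
  have hΘ : IsSolutionFromZero (prueferField k α μ c a lam) (angleAtZero α)
      (Theta0 k α μ c a lam) :=
    (hasUniqueSolutionFromZero_prueferField k μ c lam hα ha0).isSolutionFromZero
  have hX : IsSolutionFromZero (coulombField k μ c lam) (thetaPlus k c) (X0 k μ c lam) :=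
    (hasUniqueSolutionFromZero_coulombField μ lam hcI).isSolutionFromZero
  have hXη := hX.abs_sub_thetaPlus_le hcI hμ1 hl hη₀1 hcos hκ hη₀ le_rfl
    (r₀ := R) (by rw [hRdef]; linarith)
  have hXr₀ := hX.abs_sub_thetaPlus_le hcI hμ1 hl hη₀1 hcos hκ (show 0 < ε / 4 by positivity)
    (by linarith) (r₀ := |a| * T) (by linarith) _ ⟨hr₀, le_rfl⟩
  have hΘT : |Theta0 k α μ c a lam (|a| * T) - v T| ≤ ε / 4 := by
    refine hpert (fun ρ => Theta0 k α μ c a lam (|a| * ρ))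
      (fun ρ => |a| * ρ * (μ * cos (2 * Theta0 k α μ c a lam (|a| * ρ)) - lam))
      (fun ρ hρ => hasDerivAt_comp_abs_mul ha0 hΘ.1 hρ.1) (fun ρ hρ => ?_)
      (hΘ.2.comp ?_)
    · rw [abs_mul, abs_of_pos (mul_pos hapos hρ.1)]
      have h1 : |a| * ρ ≤ |a| * T := mul_le_mul_of_nonneg_left hρ.2 hapos.le
      have h2 := mul_le_mul h1 (abs_mul_cos_sub_le hμ1 hl (2 * Theta0 k α μ c a lam (|a| * ρ)))
        (abs_nonneg _) hr₀.le
      linarith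
    · refine tendsto_nhdsWithin_iff.2 ⟨?_, ?_⟩
      · have : Tendsto (fun ρ : ℝ => |a| * ρ) (𝓝 0) (𝓝 (|a| * 0)) :=
          (continuous_const.mul continuous_id).tendsto 0
        rw [mul_zero] at this
        exact this.mono_left nhdsWithin_le_nhds
      · filter_upwards [self_mem_nhdsWithin] with ρ hρ using mul_pos hapos hρ
  have hκη₀ : 2 * R ≤ k * κ := by
    have : k * κ * η₀ ≤ k * κ := mul_le_of_le_one_right (by positivity) hη₀1
    have : 0 < k * κ := by positivity
    rw [hRdef]
    linarith
  have key : |Theta0 k α μ c a lam R + m * π - X0 k μ c lam R| ≤ ε := by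
    refine abs_sub_le_of_pruefer_of_coulomb (a := a) (Y := fun r => Theta0 k α μ c a lam r + m * π)
      hk hα1 hμ1 hκ hη₀1 hcos hr₀ ha₃.le hκη₀ hε hεη₀ ?_
      (fun r hr => ?_) (fun r hr => hX.1 r (hr₀.trans_le hr.1))
      (fun r hr => hXη r ⟨hr₀.trans_le hr.1, hr.2⟩) ?_
    · rwa [div_mul_eq_div_div, div_self hapos.ne']
    · rw [prueferField_add_nat_mul_pi]
      exact (hΘ.1 r (hr₀.trans_le hr.1)).add_const _
    · rw [abs_le] at hΘT hvT hXr₀ ⊢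
      constructor <;> linarith
  rw [dist_comm, Real.dist_eq]
  linarith
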